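/- Let $T>0$, and let $\rho,k,\gamma$ be real functions on $[0,+\infty)$, extended evenly to $\mathbb R$ (same symbols), such that $\rho,k\in C^1[0,+\infty)$ are positive, $\rho k\in C^2[0,+\infty)$ and $(\rho k)'(0)=0$. Put $$\sigma(x)=\int_0^x\sqrt{\rho(|\xi|)/k(|\xi|)}\,d\xi,\quad Q_1=\sqrt{\tfrac k\rho}\,\frac{(k\rho)'}{4k\rho},\quad Q_2=\sqrt{\tfrac k\rho}\,Q_1'+Q_1^2,\quad q=Q_2-\gamma,$$ and assume that $\sigma(x)\to+\infty$ as $x\to+\infty$, $q\in L^\infty(0,+\infty)\cap C^1[0,+\infty)$ and $\sqrt{\rho/k}\,q\,\sigma\in L^1(0,+\infty)$. Let $L^2_\rho(\mathbb R)$ be the real $L^2$-space of the measure $\rho\,dx$. For $\varphi\in L^2_{\rm loc}(\mathbb R)$ put $\mathcal D_{\rho k}\varphi=\sqrt{k/\rho}\,\varphi'+Q_1\varphi$, with $\varphi'$ the distributional derivative. Let $\mathbb H^1=\{\varphi\in L^2_\rho(\mathbb R):\mathcal D_{\rho k}\varphi\in L^2_\rho(\mathbb R)\}$ with the norm $\big(\|\varphi\|^2_{L^2_\rho}+\|\mathcal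 D_{\rho k}\varphi\|^2_{L^2_\rho}\big)^{1/2}$, let $\mathbb H^{-1}=(\mathbb H^1)^*$ be its dual, and let $\widehat{\mathbb H}^{1}$, $\widehat{\mathbb H}^{-1}$ be the subspaces of even elements. Each $f\in L^2_\rho(\mathbb R)$ is identified with the functional $\varphi\mapsto\int_{\mathbb R}f\varphi\rho\,dx$ in $\mathbb H^{-1}$. For $f,\varphi\in\mathbb H^1$ put $\langle\langle\mathcal D_{\rho k}^2f,\varphi\rangle\rangle=-\int_{\mathbb R}(\mathcal D_{\rho k}f)(\mathcal D_{\rho k}\varphi)\rho\,dx$ and $\langle\langle\delta,\varphi\rangle\rangle=\varphi(0)$ (value of the continuous representative). Let $u\in L^\infty(0,T)$ and $W^0\in\widehat{\mathbb H}^1$, and let $W:[0,T]\to\widehat{\mathbb H}^1$ be a solution of $$W_t=\mathcal D_{\rho k}^2W-qW-2\sqrt{(\rho k)(0)}\,u\,\delta\ \text{ on }\mathbb R\times(0,T),\qquad W(\cdot,0)=W^0,$$ that is, $W(0)=W^0$, $W$ is absolutely continuous on $[0,T]$ as a map into $\mathbb H^{-1}$, and for almost every $t\in(0,T)$ its derivative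 $W_t(t)\in\widehat{\mathbb H}^{-1}$ exists in the norm of $\mathbb H^{-1}$ and satisfies the equation in $\mathbb H^{-1}$. Then $$(\mathcal D_{\rho k}W)(0^+,t)=u(t)\quad\text{for a.e. }t\in(0,T).$$ Moreover, for a.e. $t\in(0,T)$ the restriction $w(\cdot,t)$ of $W(\cdot,t)$ to $(0,+\infty)$ satisfies the Neumann condition $\big(\sqrt{k/\rho}\,w_x\big)(0^+,t)=u(t)$, where $w_x$ is the distributional derivative on $(0,+\infty)$. Here $g(0^+)=c$, for a function $g$ defined up to null sets, means that $g$ has essential limit $c$ as $x\to0^+$. -/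

import Mathlib

open Set Filter Topology MeasureTheory
open scoped ENNReal ContDiff

noncomputable section

namespace HalfAxisHeat

/-- `Q₁(ρ,k) = √(k/ρ) (kρ)' / (4kρ)`. For the even coefficients of `Admissible` the product `kρ` is
`C²` on the whole line, so `deriv` is the classical derivative at every point. -/
def Q1 (ρ k : ℝ → ℝ) (x : ℝ) : ℝ :=
  Real.sqrt (k x / ρ x) * deriv (fun y => k y * ρ y) x / (4 * (k x * ρ x))

/-- `Q₂(ρ,k) = √(k/ρ) (Q₁(ρ,k))' + Q₁(ρ,k)²`. -/
def Q2 (ρ k : ℝ → ℝ) (x : ℝ) : ℝ :=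
  Real.sqrt (k x / ρ x) * deriv (Q1 ρ k) x + Q1 ρ k x ^ 2

/-- The potential `q = Q₂(ρ,k) - γ`. -/
def pot (ρ k γ : ℝ → ℝ) (x : ℝ) : ℝ := Q2 ρ k x - γ x

/-- `σ(x) = ∫₀ˣ √(ρ(|ξ|)/k(|ξ|)) dξ`. -/
def sig (ρ k : ℝ → ℝ) (x : ℝ) : ℝ :=
  ∫ ξ in (0 : ℝ)..x, Real.sqrt (ρ |ξ| / k |ξ|)

/-- The standing assumptions on the coefficients, which are functions on the half-axis extended
evenly to `ℝ` (so only their values on `[0,∞)` carry information). -/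
structure Admissible (ρ k γ : ℝ → ℝ) : Prop where
  rho_even : ∀ x, ρ (-x) = ρ x
  k_even : ∀ x, k (-x) = k x
  gamma_even : ∀ x, γ (-x) = γ x
  rho_pos : ∀ x ∈ Ici (0 : ℝ), 0 < ρ x
  k_pos : ∀ x ∈ Ici (0 : ℝ), 0 < k x
  rho_C1 : ContDiffOn ℝ 1 ρ (Ici 0)
  k_C1 : ContDiffOn ℝ 1 k (Ici 0)
  rhok_C2 : ContDiffOn ℝ 2 (fun x => ρ x * k x) (Ici 0)
  rhok_deriv_zero : derivWithin (fun x => ρ x * k x) (Ici 0) 0 = 0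
  sig_tendsto : Tendsto (sig ρ k) atTop atTop
  pot_bdd : MemLp (pot ρ k γ) ∞ (volume.restrict (Ioi 0))
  pot_C1 : ContDiffOn ℝ 1 (pot ρ k γ) (Ici 0)
  pot_weight : IntegrableOn
    (fun x => Real.sqrt (ρ x / k x) * pot ρ k γ x * sig ρ k x) (Ioi 0)

/-- `f'` is the derivative of `f` in the sense of distributions on the open set `Ω`; both functions
are locally integrable there. -/
structure IsWeakDerivOn (Ω : Set ℝ) (f f' : ℝ → ℝ) : Prop where
  loc : LocallyIntegrableOn f Ω
  loc_deriv : LocallyIntegrableOn f' Ω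
  by_parts : ∀ ψ : ℝ → ℝ, ContDiff ℝ ∞ ψ → HasCompactSupport ψ → tsupport ψ ⊆ Ω →
    ∫ x, f x * deriv ψ x = - ∫ x, f' x * ψ x

/-- The measure `ρ dx` on `ℝ`. -/
def rhoMeasure (ρ : ℝ → ℝ) : Measure ℝ := volume.withDensity (fun x => ENNReal.ofReal (ρ x))

/-- The weighted space `L²_ρ(ℝ)`. -/
abbrev L2rho (ρ : ℝ → ℝ) : Type := Lp ℝ 2 (rhoMeasure ρ)

theorem IsWeakDerivOn.zero : IsWeakDerivOn univ (fun _ => 0) (fun _ => 0) :=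
  ⟨(locallyIntegrable_const 0).locallyIntegrableOn _,
    (locallyIntegrable_const 0).locallyIntegrableOn _, by simp⟩

theorem IsWeakDerivOn.smul {f f' : ℝ → ℝ} (c : ℝ) (h : IsWeakDerivOn univ f f') :
    IsWeakDerivOn univ (fun x => c * f x) (fun x => c * f' x) := by
  refine ⟨h.loc.smul c, h.loc_deriv.smul c, fun ψ h1 h2 h3 => ?_⟩
  simp only [mul_assoc, integral_const_mul]
  rw [h.by_parts ψ h1 h2 h3, mul_neg]

theorem IsWeakDerivOn.add {f f' g g' : ℝ → ℝ} (hf : IsWeakDerivOn univ f f')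
    (hg : IsWeakDerivOn univ g g') :
    IsWeakDerivOn univ (fun x => f x + g x) (fun x => f' x + g' x) := by
  have lf := locallyIntegrableOn_univ.1 hf.loc
  have lf' := locallyIntegrableOn_univ.1 hf.loc_deriv
  have lg := locallyIntegrableOn_univ.1 hg.loc
  have lg' := locallyIntegrableOn_univ.1 hg.loc_deriv
  refine ⟨locallyIntegrableOn_univ.2 (lf.add lg), locallyIntegrableOn_univ.2 (lf'.add lg'),
    fun ψ h1 h2 h3 => ?_⟩
  have hd : Continuous (deriv ψ) := h1.continuous_deriv (by simp)
  have i1 : ∀ {u : ℝ → ℝ}, LocallyIntegrable u → Integrable (fun x => u x * deriv ψ x) :=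
    fun hu => hu.integrable_smul_right_of_hasCompactSupport hd h2.deriv
  have i2 : ∀ {u : ℝ → ℝ}, LocallyIntegrable u → Integrable (fun x => u x * ψ x) :=
    fun hu => hu.integrable_smul_right_of_hasCompactSupport h1.continuous h2
  simp only [add_mul]
  rw [integral_add (i1 lf) (i1 lg), integral_add (i2 lf') (i2 lg'),
    hf.by_parts ψ h1 h2 h3, hg.by_parts ψ h1 h2 h3]
  ring

/-- The modified Sobolev space `ℍ¹`: all `φ ∈ L²_ρ(ℝ)` such that
`𝔻φ = √(k/ρ) φ' + Q₁(ρ,k) φ` belongs to `L²_ρ(ℝ)`, where `φ'` is the distributional derivative.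
It is realised as the graph `{(φ, 𝔻φ)}` in the Hilbert sum `L²_ρ ⊕ L²_ρ`, so that the norm it
inherits is `(‖φ‖² + ‖𝔻φ‖²)^{1/2}` with the norms of `L²_ρ(ℝ)`. -/
def H1 (ρ k : ℝ → ℝ) : Submodule ℝ (WithLp 2 (L2rho ρ × L2rho ρ)) where
  carrier := {p | ∃ f f' : ℝ → ℝ, p.fst =ᵐ[rhoMeasure ρ] f ∧ IsWeakDerivOn univ f f' ∧
    p.snd =ᵐ[rhoMeasure ρ] fun x => Real.sqrt (k x / ρ x) * f' x + Q1 ρ k x * f x}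
  zero_mem' := by
    refine ⟨fun _ => 0, fun _ => 0, Lp.coeFn_zero _ _ _, .zero, ?_⟩
    filter_upwards [Lp.coeFn_zero ℝ 2 (rhoMeasure ρ)] with x hx
    simpa using hx
  add_mem' := by
    rintro p r ⟨f, f', hf, hff, hf'⟩ ⟨g, g', hg, hgg, hg'⟩
    refine ⟨_, _, ?_, hff.add hgg, ?_⟩
    · filter_upwards [Lp.coeFn_add p.fst r.fst, hf, hg] with x h1 h2 h3
      rw [WithLp.add_fst, h1, Pi.add_apply, h2, h3]
    · filter_upwards [Lp.coeFn_add p.snd r.snd, hf', hg'] with x h1 h2 h3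
      rw [WithLp.add_snd, h1, Pi.add_apply, h2, h3]
      ring
  smul_mem' := by
    rintro c p ⟨f, f', hf, hff, hf'⟩
    refine ⟨_, _, ?_, hff.smul c, ?_⟩
    · filter_upwards [Lp.coeFn_smul c p.fst, hf] with x h1 h2
      rw [WithLp.smul_fst, h1, Pi.smul_apply, h2, smul_eq_mul]
    · filter_upwards [Lp.coeFn_smul c p.snd, hf'] with x h1 h2
      rw [WithLp.smul_snd, h1, Pi.smul_apply, h2, smul_eq_mul]
      ring

variable {ρ k : ℝ → ℝ}

/-- The function underlying an element of `ℍ¹`. -/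
def fn (φ : H1 ρ k) : L2rho ρ := φ.1.fst

/-- The derivative `𝔻φ ∈ L²_ρ(ℝ)` of an element `φ` of `ℍ¹`. -/
def opD (φ : H1 ρ k) : L2rho ρ := φ.1.snd

/-- `φ` is an even element of `ℍ¹`. -/
def IsEven (φ : H1 ρ k) : Prop := ∀ᵐ x : ℝ, fn φ (-x) = fn φ x

/-- The space `ℍ⁻¹`, the dual of `ℍ¹`, with the dual norm. -/
abbrev Hneg1 (ρ k : ℝ → ℝ) : Type := StrongDual ℝ (H1 ρ k)

/-- The embedding `ℍ¹ ⊂ L²_ρ(ℝ) ⊂ ℍ⁻¹`, `⟨⟨f, φ⟩⟩ = ∫ f φ ρ dx`. -/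
def toHneg1 (f : H1 ρ k) : Hneg1 ρ k :=
  (innerSL ℝ (fn f)).comp
    ((WithLp.fstL 2 ℝ (L2rho ρ) (L2rho ρ)).comp (H1 ρ k).subtypeL)

theorem toHneg1_apply (f φ : H1 ρ k) :
    toHneg1 f φ = ∫ x, fn f x * fn φ x ∂(rhoMeasure ρ) := by
  change inner ℝ (fn f) (fn φ) = _
  rw [L2.inner_def]
  exact integral_congr_ae (ae_of_all _ fun x => by simp [mul_comm])

/-- The function `f`, defined up to null sets, has the one-sided limit `f(0⁺) = c`
(an essential limit: for every `ε > 0` there is `η > 0` with `|f x - c| < ε` for a.e.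
`x ∈ (0, η)`). -/
def HasValueAtZeroPlus (f : ℝ → ℝ) (c : ℝ) : Prop :=
  Tendsto f (𝓝[>] 0 ⊓ ae volume) (𝓝 c)

/-- The value at `0` of a function that is defined up to null sets and has a continuous
representative, as every element of `ℍ¹` does. -/
def valueAtZero (f : ℝ → ℝ) : ℝ := limUnder (𝓝 0 ⊓ ae volume) f

theorem zero_inf_ae_neBot : (𝓝 (0 : ℝ) ⊓ ae (volume : Measure ℝ)).NeBot := by
  rw [inf_neBot_iff]
  intro s hs t ht
  obtain ⟨ε, hε, h⟩ := Metric.mem_nhds_iff.1 hs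
  by_contra hne
  have hsub : Metric.ball (0 : ℝ) ε ⊆ tᶜ := fun x hx hxt => hne ⟨x, h hx, hxt⟩
  have h0 : volume (Metric.ball (0 : ℝ) ε) = 0 := measure_mono_null hsub ht
  exact (Metric.measure_ball_pos volume (0 : ℝ) hε).ne' h0

theorem valueAtZero_eq {f g : ℝ → ℝ} (h : f =ᵐ[volume] g) (hg : ContinuousAt g 0) :
    valueAtZero f = g 0 := by
  have := zero_inf_ae_neBot
  refine Tendsto.limUnder_eq ?_
  have h1 : Tendsto g (𝓝 0 ⊓ ae volume) (𝓝 (g 0)) := hg.tendsto.mono_left inf_le_left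
  exact h1.congr' (inf_le_right (a := 𝓝 (0 : ℝ)) h.symm)

/-- `F ∈ ℍ⁻¹` equals `𝔻²f - q f - 2 √((ρk)(0)) c δ`. Here `⟨⟨𝔻²f, φ⟩⟩ = -⟨⟨𝔻f, 𝔻φ⟩⟩`,
`⟨⟨qf, φ⟩⟩ = ∫ q f φ ρ dx` and `⟨⟨δ, φ⟩⟩ = φ(0)` for all `φ ∈ ℍ¹`. -/
def EqRHS (γ : ℝ → ℝ) (c : ℝ) (f : H1 ρ k) (F : Hneg1 ρ k) : Prop :=
  ∀ φ : H1 ρ k, F φ =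
    - (∫ x, opD f x * opD φ x ∂(rhoMeasure ρ))
    - (∫ x, pot ρ k γ x * fn f x * fn φ x ∂(rhoMeasure ρ))
    - 2 * Real.sqrt (ρ 0 * k 0) * c * valueAtZero (fn φ)

/-- `W : [0,T] → ℍ¹` (even for every `t`) is a solution of
`W_t = 𝔻²W - qW - 2 √((ρk)(0)) u δ` on `ℝ × (0,T)`, `W(·,0) = W⁰`: as a map into `ℍ⁻¹` it is
absolutely continuous on `[0,T]`, and for almost every `t` its derivative in `ℍ⁻¹` exists and
satisfies the equation. Values of `W` outside `[0,T]` play no role. -/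
structure IsSolution (γ : ℝ → ℝ) (T : ℝ) (u : ℝ → ℝ) (W0 : H1 ρ k) (W : ℝ → H1 ρ k) :
    Prop where
  even : ∀ t ∈ Icc 0 T, IsEven (W t)
  abs_cont : AbsolutelyContinuousOnInterval (fun t => toHneg1 (W t)) 0 T
  equation : ∀ᵐ t ∂(volume.restrict (Ioo 0 T)), ∃ F : Hneg1 ρ k,
    HasDerivAt (fun s => toHneg1 (W s)) F t ∧ EqRHS γ (u t) (W t) F
  initial : W 0 = W0

end HalfAxisHeat

end

/-!
In the variable `y = σ(x)` and after multiplication by `m = (kρ)^{1/4}`, the space `ℍ¹` becomes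
`H¹(ℝ)` and `𝔻_{ρk}` becomes `d/dy`, so the lift `g_t` of `W(t)` is an even solution of the flat
heat equation with source `-2 m(0) u δ` and a forcing that is integrable in time with values in
`L²`. Pairing it with a difference of two translates of the backward heat kernel `G_{t₀-t}`,
centred at `b` and `a` with `0 < a ≤ b ≤ 2a`, bounds the increment `g_{t₀}(b) - g_{t₀}(a)` by
`b - a` times the sum of three terms: the data at a time `t₁ < t₀` enter only through the even part
of the kernel difference and contribute `O(b)`; the forcing contributes
`∫ H(t) (t₀ - t)^{-3/4} dt`, which is small for `t₁` near `t₀` at almost every `t₀`; the source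
contributes `∫ |u(t)| a (a² + t₀ - t)^{-3/2} dt`. Subtracting the corner function
`-m(0) u(t₀) e^{-|y|}`, whose second derivative carries the mass `2 m(0) u(t₀) δ`, replaces `u` by
`u - u(t₀)`; at a Lebesgue point `t₀` the source term is then small too. So all slopes near `0⁺`
are small, the derivative of the lift tends to `m(0) u(t₀)`, and undoing the change of variables
gives `(𝔻_{ρk} W)(0⁺) = u(t₀)`. The Neumann condition follows since `Q₁(0) = 0`.
-/

namespace HalfAxisHeat

/-! ### Even functions -/

theorem apply_abs_of_even {f : ℝ → ℝ} (he : ∀ x, f (-x) = f x) (x : ℝ) : f |x| = f x := by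
  rcases abs_choice x with h | h <;> simp only [h, he]

theorem continuous_of_even {f : ℝ → ℝ} (he : ∀ x, f (-x) = f x) (hc : ContinuousOn f (Ici 0)) :
    Continuous f := by
  have h := hc.comp_continuous continuous_abs abs_nonneg
  rwa [show f ∘ abs = f from funext (apply_abs_of_even he)] at h

theorem contDiff_one_of_even {f : ℝ → ℝ} (he : ∀ x, f (-x) = f x)
    (hc : ContDiffOn ℝ 1 f (Ici 0)) (h0 : derivWithin f (Ici 0) 0 = 0) : ContDiff ℝ 1 f := by
  set d := derivWithin f (Ici 0)
  have hpos : ∀ x > 0, HasDerivAt f (d x) x := fun x hx =>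
    ((hc.differentiableOn one_ne_zero) x hx.le).hasDerivWithinAt.hasDerivAt (Ici_mem_nhds hx)
  have hneg : ∀ x < 0, HasDerivAt f (-d (-x)) x := fun x hx => by
    simpa [Function.comp_def, he] using (hpos (-x) (neg_pos.2 hx)).comp x (hasDerivAt_neg x)
  have hd : Continuous fun x => d (max x 0) :=
    (hc.continuousOn_derivWithin (uniqueDiffOn_Ici 0) le_rfl).comp_continuous
      (continuous_id.max continuous_const) fun x => le_max_right x 0
  have hodd : Continuous fun x => d (max x 0) - d (max (-x) 0) :=
    hd.sub (hd.comp continuous_neg)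
  have hderiv_ne : ∀ x ≠ 0, HasDerivAt f (d (max x 0) - d (max (-x) 0)) x := by
    intro x hx
    rcases hx.lt_or_gt with hx | hx
    · simpa [hx.le, h0] using hneg x hx
    · simpa [hx.le, h0] using hpos x hx
  have hderiv := hasDerivAt_of_hasDerivAt_of_ne' hderiv_ne
    (continuous_of_even he hc.continuousOn).continuousAt hodd.continuousAt
  refine contDiff_one_iff_deriv.2 ⟨fun x => (hderiv x).differentiableAt, ?_⟩
  rwa [funext fun x => (hderiv x).deriv]

theorem memLp_of_even {f : ℝ → ℝ} {p : ℝ≥0∞} (he : ∀ x, f (-x) = f x)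
    (hf : MemLp f p (volume.restrict (Ioi 0))) : MemLp f p := by
  have hpos : MemLp ((Ioi 0).indicator f) p := (memLp_indicator_iff_restrict measurableSet_Ioi).2 hf
  have hneg := hpos.comp_measurePreserving (Measure.measurePreserving_neg volume)
  refine (memLp_congr_ae ?_).1 (hpos.add hneg)
  filter_upwards [compl_mem_ae_iff.2 (measure_singleton (0 : ℝ))] with x hx
  rcases lt_or_gt_of_ne (show x ≠ 0 from hx) with hx | hx
  · simp [hx, hx.le, he]
  · simp [hx, hx.le]

/-! ### Locally absolutely continuous functions -/

/-- `g` is locally absolutely continuous on `ℝ` with almost everywhere derivative `g'`, encoded by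
the fundamental theorem of calculus. -/
structure IsPrimitive (g g' : ℝ → ℝ) : Prop where
  locallyIntegrable : LocallyIntegrable g'
  sub_eq_integral : ∀ a b, g b - g a = ∫ x in a..b, g' x

theorem intervalIntegrable_of_locallyIntegrable {f : ℝ → ℝ} (h : LocallyIntegrable f) (a b : ℝ) :
    IntervalIntegrable f volume a b :=
  intervalIntegrable_iff.2 ((h.integrableOn_isCompact isCompact_uIcc).mono_set uIoc_subset_uIcc)

theorem locallyIntegrable_of_intervalIntegrable {f : ℝ → ℝ}
    (h : ∀ a b, IntervalIntegrable f volume a b) : LocallyIntegrable f := fun x =>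
  ⟨Icc (x - 1) (x + 1), Icc_mem_nhds (by linarith) (by linarith),
    (intervalIntegrable_iff_integrableOn_Icc_of_le (by linarith)).1 (h _ _)⟩

theorem isPrimitive_of_hasDerivAt_off_countable {g g' : ℝ → ℝ} {s : Set ℝ} (hs : s.Countable)
    (hc : Continuous g) (hd : ∀ x ∉ s, HasDerivAt g (g' x) x) (hi : LocallyIntegrable g') :
    IsPrimitive g g' :=
  ⟨hi, fun a b => (integral_eq_of_hasDerivAt_off_countable g g' hs hc.continuousOn
    (fun x hx => hd x hx.2) (intervalIntegrable_of_locallyIntegrable hi a b)).symm⟩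

theorem isPrimitive_of_hasDerivAt {g g' : ℝ → ℝ} (hd : ∀ x, HasDerivAt g (g' x) x)
    (hc : Continuous g') : IsPrimitive g g' :=
  isPrimitive_of_hasDerivAt_off_countable countable_empty
    (continuous_iff_continuousAt.2 fun x => (hd x).continuousAt) (fun x _ => hd x)
    hc.locallyIntegrable

theorem isPrimitive_of_contDiff {ψ : ℝ → ℝ} (h : ContDiff ℝ 1 ψ) : IsPrimitive ψ (deriv ψ) :=
  isPrimitive_of_hasDerivAt (fun x => (h.differentiable one_ne_zero x).hasDerivAt)
    (h.continuous_deriv le_rfl)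

theorem isPrimitive_integral {f : ℝ → ℝ} (h : LocallyIntegrable f) (c : ℝ) :
    IsPrimitive (fun x => c + ∫ t in (0 : ℝ)..x, f t) f :=
  ⟨h, fun a b => by
    rw [add_sub_add_left_eq_sub, intervalIntegral.integral_interval_sub_left] <;>
      exact intervalIntegrable_of_locallyIntegrable h _ _⟩

namespace IsPrimitive

variable {g g' : ℝ → ℝ}

theorem intervalIntegrable (h : IsPrimitive g g') (a b : ℝ) : IntervalIntegrable g' volume a b :=
  intervalIntegrable_of_locallyIntegrable h.locallyIntegrable a b

theorem eq_add_integral (h : IsPrimitive g g') (a x : ℝ) : g x = g a + ∫ t in a..x, g' t := by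
  rw [← h.sub_eq_integral, add_sub_cancel]

theorem continuous (h : IsPrimitive g g') : Continuous g := by
  rw [funext (h.eq_add_integral 0)]
  exact continuous_const.add (intervalIntegral.continuous_primitive h.intervalIntegrable 0)

theorem ae_hasDerivAt (h : IsPrimitive g g') : ∀ᵐ x, HasDerivAt g (g' x) x := by
  filter_upwards [LocallyIntegrable.ae_hasDerivAt_integral h.locallyIntegrable] with x hx
  simpa only [← h.eq_add_integral 0] using (hx 0).const_add (g 0)

theorem absolutelyContinuousOnInterval (h : IsPrimitive g g') (a b : ℝ) :
    AbsolutelyContinuousOnInterval g a b := by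
  have hconst : AbsolutelyContinuousOnInterval (fun _ : ℝ => g a) a b :=
    (LipschitzWith.const (g a)).lipschitzOnWith.absolutelyContinuousOnInterval
  have hsum := hconst.fun_add
    ((h.intervalIntegrable a b).absolutelyContinuousOnInterval_intervalIntegral left_mem_uIcc)
  rwa [← funext (h.eq_add_integral a)] at hsum

theorem add {f f' : ℝ → ℝ} (h : IsPrimitive g g') (hf : IsPrimitive f f') :
    IsPrimitive (fun x => g x + f x) (fun x => g' x + f' x) :=
  ⟨h.locallyIntegrable.add hf.locallyIntegrable, fun a b => by
    rw [intervalIntegral.integral_add (h.intervalIntegrable a b) (hf.intervalIntegrable a b),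
      ← h.sub_eq_integral, ← hf.sub_eq_integral]
    ring⟩

theorem const_mul (h : IsPrimitive g g') (c : ℝ) :
    IsPrimitive (fun x => c * g x) (fun x => c * g' x) :=
  ⟨h.locallyIntegrable.smul c, fun a b => by
    rw [intervalIntegral.integral_const_mul, ← h.sub_eq_integral, mul_sub]⟩

theorem mul {m m' : ℝ → ℝ} (h : IsPrimitive g g') (hm : IsPrimitive m m') :
    IsPrimitive (fun x => g x * m x) (fun x => g' x * m x + g x * m' x) := by
  refine ⟨locallyIntegrable_of_intervalIntegrable fun a b =>
    ((h.intervalIntegrable a b).mul_continuousOn hm.continuous.continuousOn).add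
      ((hm.intervalIntegrable a b).continuousOn_mul h.continuous.continuousOn), fun a b => ?_⟩
  rw [← (h.absolutelyContinuousOnInterval a b).integral_deriv_mul_eq_sub
    (hm.absolutelyContinuousOnInterval a b)]
  refine intervalIntegral.integral_congr_ae ?_
  filter_upwards [h.ae_hasDerivAt, hm.ae_hasDerivAt] with x hg hm _
  rw [hg.deriv, hm.deriv]

theorem comp {τ τ' : ℝ → ℝ} (h : IsPrimitive g g') (hτ : ∀ x, HasDerivAt τ (τ' x) x)
    (hpos : ∀ x, 0 ≤ τ' x) : IsPrimitive (fun y => g (τ y)) (fun y => g' (τ y) * τ' y) := by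
  have hc : Continuous τ := continuous_iff_continuousAt.2 fun x => (hτ x).continuousAt
  refine ⟨locallyIntegrable_of_intervalIntegrable fun a b => ?_, fun a b => ?_⟩
  · exact (intervalIntegral.integrable_comp_mul_deriv_iff_of_deriv_nonneg hc.continuousOn
      (fun x _ => hτ x) fun x _ => hpos x).2 (h.intervalIntegrable _ _)
  · rw [h.sub_eq_integral]
    exact (intervalIntegral.integral_comp_mul_deriv_of_deriv_nonneg hc.continuousOn
      (fun x _ => hτ x) fun x _ => hpos x).symm

theorem comp_neg (h : IsPrimitive g g') : IsPrimitive (fun x => g (-x)) fun x => -g' (-x) := by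
  refine ⟨locallyIntegrable_of_intervalIntegrable fun a b => ?_, fun a b => ?_⟩
  · have := (h.intervalIntegrable (-a) (-b)).comp_sub_left 0
    simp only [zero_sub, neg_neg] at this
    exact this.neg
  · rw [intervalIntegral.integral_neg, intervalIntegral.integral_comp_neg,
      ← intervalIntegral.integral_symm, h.sub_eq_integral]

theorem tendsto_atTop_zero {a : ℝ} (h : IsPrimitive g g') (hg : IntegrableOn g (Ioi a))
    (hg' : IntegrableOn g' (Ioi a)) : Tendsto g atTop (𝓝 0) := by
  have hlim : Tendsto g atTop (𝓝 (g a + ∫ t in Ioi a, g' t)) := by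
    rw [funext (h.eq_add_integral a)]
    simpa using (intervalIntegral_tendsto_integral_Ioi a hg' tendsto_id).const_add (g a)
  have hzero : g a + ∫ t in Ioi a, g' t = 0 := by
    refine IntegrableAtFilter.eq_zero_of_tendsto ⟨Ioi a, Ioi_mem_atTop a, hg⟩ (fun s hs => ?_) hlim
    obtain ⟨b, hb⟩ := mem_atTop_sets.1 hs
    exact measure_mono_top (show Ici b ⊆ s from hb) Real.volume_Ici
  rwa [hzero] at hlim

theorem integral_Ioi_eq {a : ℝ} (h : IsPrimitive g g') (hg : IntegrableOn g (Ioi a))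
    (hg' : IntegrableOn g' (Ioi a)) : ∫ x in Ioi a, g' x = -g a := by
  have hlim := (h.tendsto_atTop_zero hg hg').sub_const (g a)
  simp only [h.sub_eq_integral, zero_sub] at hlim
  exact tendsto_nhds_unique (intervalIntegral_tendsto_integral_Ioi a hg' tendsto_id) hlim

theorem integral_Iic_eq {a : ℝ} (h : IsPrimitive g g') (hg : IntegrableOn g (Iic a))
    (hg' : IntegrableOn g' (Iic a)) : ∫ x in Iic a, g' x = g a := by
  have hrefl : ∀ {f : ℝ → ℝ}, IntegrableOn f (Iic a) → IntegrableOn (fun x => f (-x)) (Ioi (-a)) :=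
    fun hf => by
      rw [← integrableOn_Ici_iff_integrableOn_Ioi]
      simpa using hf.comp_neg
  have := h.comp_neg.integral_Ioi_eq (hrefl hg) (hrefl hg').neg
  simpa [integral_neg, integral_comp_neg_Ioi] using this

theorem integral_eq_zero (h : IsPrimitive g g') (hg : Integrable g) (hg' : Integrable g') :
    ∫ x, g' x = 0 := by
  rw [← intervalIntegral.integral_Iic_add_Ioi hg'.integrableOn hg'.integrableOn (b := 0),
    h.integral_Iic_eq hg.integrableOn hg'.integrableOn,
    h.integral_Ioi_eq hg.integrableOn hg'.integrableOn, add_neg_cancel]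

theorem integral_mul_deriv_eq_neg {ψ ψ' : ℝ → ℝ} (h : IsPrimitive g g') (hψ : IsPrimitive ψ ψ')
    (hgψ : Integrable fun x => g x * ψ x) (hg'ψ : Integrable fun x => g' x * ψ x)
    (hgψ' : Integrable fun x => g x * ψ' x) : ∫ x, g x * ψ' x = -∫ x, g' x * ψ x := by
  have := (h.mul hψ).integral_eq_zero hgψ (hg'ψ.add hgψ')
  rw [integral_add hg'ψ hgψ'] at this
  linarith

theorem sq_le_integral (h : IsPrimitive g g') (hg : MemLp g 2) (hg' : MemLp g' 2) (x : ℝ) :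
    g x ^ 2 ≤ (∫ y, g y ^ 2) + ∫ y, g' y ^ 2 := by
  have hgg' : Integrable fun y => g' y * g y + g y * g' y :=
    (hg'.integrable_mul hg).add (hg.integrable_mul hg')
  have hsum : Integrable fun y => g y ^ 2 + g' y ^ 2 := hg.integrable_sq.add hg'.integrable_sq
  calc g x ^ 2 = ∫ y in Iic x, (g' y * g y + g y * g' y) := by
        rw [(h.mul h).integral_Iic_eq (hg.integrable_mul hg).integrableOn hgg'.integrableOn, sq]
    _ ≤ ∫ y in Iic x, (g y ^ 2 + g' y ^ 2) :=
        setIntegral_mono hgg'.integrableOn hsum.integrableOn fun y => by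
          nlinarith [sq_nonneg (g y - g' y)]
    _ ≤ ∫ y, (g y ^ 2 + g' y ^ 2) :=
        setIntegral_le_integral hsum (ae_of_all _ fun y => by positivity)
    _ = _ := integral_add hg.integrable_sq hg'.integrable_sq

end IsPrimitive

/-! ### Weak derivatives on the line -/

theorem IsPrimitive.isWeakDerivOn {g g' : ℝ → ℝ} (h : IsPrimitive g g') :
    IsWeakDerivOn univ g g' := by
  have hg := h.continuous.locallyIntegrable (μ := volume)
  refine ⟨locallyIntegrableOn_univ.2 hg, locallyIntegrableOn_univ.2 h.locallyIntegrable,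
    fun ψ hψ hsupp _ => ?_⟩
  have hψ1 : ContDiff ℝ 1 ψ := hψ.of_le (by simp)
  exact h.integral_mul_deriv_eq_neg (isPrimitive_of_contDiff hψ1)
    (hg.integrable_smul_right_of_hasCompactSupport hψ.continuous hsupp)
    (h.locallyIntegrable.integrable_smul_right_of_hasCompactSupport hψ.continuous hsupp)
    (hg.integrable_smul_right_of_hasCompactSupport (hψ1.continuous_deriv le_rfl) hsupp.deriv)

theorem exists_hasCompactSupport_deriv_eq {θ : ℝ → ℝ} (hθ : ContDiff ℝ ∞ θ)
    (hsupp : HasCompactSupport θ) (hint : ∫ x, θ x = 0) :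
    ∃ Θ : ℝ → ℝ, ContDiff ℝ ∞ Θ ∧ HasCompactSupport Θ ∧ deriv Θ = θ := by
  obtain ⟨R, -, hR⟩ := hsupp.isCompact.isBounded.subset_ball_lt 0 0
  rw [Real.ball_eq_Ioo, zero_sub, zero_add] at hR
  have hderiv : ∀ x, HasDerivAt (fun x => ∫ t in (-R)..x, θ t) (θ x) x := fun x =>
    (hθ.continuous.integral_hasStrictDerivAt (-R) x).hasDerivAt
  have hderiv_eq := funext fun x => (hderiv x).deriv
  refine ⟨fun x => ∫ t in (-R)..x, θ t, ?_, ?_, hderiv_eq⟩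
  · rw [contDiff_infty_iff_deriv, hderiv_eq]
    exact ⟨fun x => (hderiv x).differentiableAt, hθ⟩
  · refine HasCompactSupport.intro (isCompact_Icc (a := -R) (b := R)) fun x hx => ?_
    rcases lt_or_ge x (-R) with hlt | hge
    · refine intervalIntegral.integral_zero_ae (ae_of_all _ fun t ht => ?_)
      rw [uIoc_of_ge hlt.le] at ht
      exact image_eq_zero_of_notMem_tsupport fun hmem => (hR hmem).1.not_ge ht.2
    · have hgt : R < x := lt_of_not_ge fun hle => hx ⟨hge, hle⟩
      rw [intervalIntegral.integral_eq_integral_of_support_subset, hint]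
      exact fun t ht => ⟨(hR (subset_tsupport θ ht)).1,
        ((hR (subset_tsupport θ ht)).2.trans hgt).le⟩

theorem ae_eq_const_of_weakDeriv_eq_zero {w : ℝ → ℝ} (hw : LocallyIntegrable w)
    (h : ∀ ψ : ℝ → ℝ, ContDiff ℝ ∞ ψ → HasCompactSupport ψ → ∫ x, w x * deriv ψ x = 0) :
    ∃ c, ∀ᵐ x, w x = c := by
  let b : ContDiffBump (0 : ℝ) := ⟨1, 2, one_pos, one_lt_two⟩
  set χ : ℝ → ℝ := b.normed volume
  have hχ : ContDiff ℝ ∞ χ := b.contDiff_normed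
  have hχs : HasCompactSupport χ := b.hasCompactSupport_normed
  have hχi := hχ.continuous.integrable_of_hasCompactSupport hχs (μ := volume)
  have hwχ : Integrable fun x => w x * χ x :=
    hw.integrable_smul_right_of_hasCompactSupport hχ.continuous hχs
  refine ⟨∫ x, w x * χ x, ae_eq_of_integral_contDiff_smul_eq hw (locallyIntegrable_const _)
    fun η hη hηs => ?_⟩
  have hηi := hη.continuous.integrable_of_hasCompactSupport hηs (μ := volume)
  have hwη : Integrable fun x => w x * η x :=
    hw.integrable_smul_right_of_hasCompactSupport hη.continuous hηs
  have hmean : ∫ x, (η x - (∫ t, η t) * χ x) = 0 := by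
    rw [integral_sub hηi (hχi.const_mul _), integral_const_mul, b.integral_normed, mul_one,
      sub_self]
  obtain ⟨Θ, hΘ, hΘs, hΘ'⟩ := exists_hasCompactSupport_deriv_eq
    (hη.sub (contDiff_const.mul hχ)) (hηs.sub (hχs.mul_left (f := fun _ => ∫ t, η t))) hmean
  have hzero : ∫ x, (w x * η x - (∫ t, η t) * (w x * χ x)) = 0 := by
    rw [← h Θ hΘ hΘs, hΘ']
    exact integral_congr_ae (ae_of_all _ fun x => by ring)
  rw [integral_sub hwη (hwχ.const_mul _), integral_const_mul, sub_eq_zero] at hzero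
  simp only [smul_eq_mul, integral_mul_const, mul_comm (η _) (w _)]
  exact hzero

theorem IsWeakDerivOn.exists_isPrimitive {f f' : ℝ → ℝ} (h : IsWeakDerivOn univ f f') :
    ∃ F, f =ᵐ[volume] F ∧ IsPrimitive F f' := by
  have hF := isPrimitive_integral (locallyIntegrableOn_univ.1 h.loc_deriv) 0
  have hdiff := h.add (hF.isWeakDerivOn.smul (-1))
  obtain ⟨c, hc⟩ := ae_eq_const_of_weakDeriv_eq_zero (locallyIntegrableOn_univ.1 hdiff.loc)
    fun ψ hψ hsupp => by simpa using hdiff.by_parts ψ hψ hsupp (subset_univ _)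
  refine ⟨_, ?_, isPrimitive_integral hF.locallyIntegrable c⟩
  filter_upwards [hc] with x hx
  linarith

/-! ### The Liouville change of variables -/

/-- What the Liouville change of variables `y = σ(x)` needs of the coefficients, as functions on the
whole line. -/
structure LiouvilleCoefficients (ρ k : ℝ → ℝ) : Prop where
  rho_even : ∀ x, ρ (-x) = ρ x
  k_even : ∀ x, k (-x) = k x
  rho_pos : ∀ x, 0 < ρ x
  k_pos : ∀ x, 0 < k x
  continuous_rho : Continuous ρ
  continuous_k : Continuous k
  contDiff_mul : ContDiff ℝ 1 fun x => k x * ρ x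
  sig_tendsto : Tendsto (sig ρ k) atTop atTop

/-- The derivative `σ' = √(ρ/k)`. -/
noncomputable def sigDeriv (ρ k : ℝ → ℝ) (x : ℝ) : ℝ := √(ρ x / k x)

/-- The Liouville weight `m = (kρ)^{1/4}`, which satisfies `ρ = m² σ'` and `m' = m σ' Q₁`. -/
noncomputable def liouvilleWeight (ρ k : ℝ → ℝ) (x : ℝ) : ℝ := √√(k x * ρ x)

theorem sqrt_k_div_rho (ρ k : ℝ → ℝ) (x : ℝ) : √(k x / ρ x) = (sigDeriv ρ k x)⁻¹ := by
  rw [sigDeriv, ← Real.sqrt_inv, inv_div]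

theorem liouvilleWeight_sq (ρ k : ℝ → ℝ) (x : ℝ) : liouvilleWeight ρ k x ^ 2 = √(k x * ρ x) :=
  Real.sq_sqrt (Real.sqrt_nonneg _)

theorem sig_zero (ρ k : ℝ → ℝ) : sig ρ k 0 = 0 := intervalIntegral.integral_same

theorem quasiMeasurePreserving_of_leftInverse {f g : ℝ → ℝ} (hf : Measurable f)
    (hg : Differentiable ℝ g) (h : Function.LeftInverse g f) :
    Measure.QuasiMeasurePreserving f := by
  refine ⟨hf, Measure.AbsolutelyContinuous.mk fun s hs hs0 => ?_⟩
  rw [Measure.map_apply hf hs]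
  exact measure_mono_null (preimage_subset_image_of_inverse h s)
    (addHaar_image_eq_zero_of_differentiableOn_of_addHaar_eq_zero volume hg.differentiableOn hs0)

variable {ρ k : ℝ → ℝ}

namespace LiouvilleCoefficients

variable (h : LiouvilleCoefficients ρ k)
include h

theorem sigDeriv_pos (x : ℝ) : 0 < sigDeriv ρ k x :=
  Real.sqrt_pos.2 (div_pos (h.rho_pos x) (h.k_pos x))

theorem continuous_sigDeriv : Continuous (sigDeriv ρ k) :=
  (h.continuous_rho.div h.continuous_k fun x => (h.k_pos x).ne').sqrt

theorem sig_eq_integral (x : ℝ) : sig ρ k x = ∫ ξ in (0 : ℝ)..x, sigDeriv ρ k ξ := by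
  simp only [sig, sigDeriv, apply_abs_of_even h.rho_even, apply_abs_of_even h.k_even]

theorem hasDerivAt_sig (x : ℝ) : HasDerivAt (sig ρ k) (sigDeriv ρ k x) x := by
  rw [funext h.sig_eq_integral]
  exact (h.continuous_sigDeriv.integral_hasStrictDerivAt 0 x).hasDerivAt

theorem continuous_sig : Continuous (sig ρ k) :=
  continuous_iff_continuousAt.2 fun x => (h.hasDerivAt_sig x).continuousAt

theorem strictMono_sig : StrictMono (sig ρ k) :=
  strictMono_of_deriv_pos fun x => by
    rw [(h.hasDerivAt_sig x).deriv]
    exact h.sigDeriv_pos x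

theorem sig_neg (x : ℝ) : sig ρ k (-x) = -sig ρ k x := by
  have hcomp := intervalIntegral.integral_comp_neg (a := 0) (b := x) (sigDeriv ρ k)
  simp only [sigDeriv, h.rho_even, h.k_even, neg_zero] at hcomp
  rw [h.sig_eq_integral, h.sig_eq_integral, intervalIntegral.integral_symm]
  simp only [sigDeriv, hcomp]

theorem surjective_sig : Function.Surjective (sig ρ k) := by
  refine h.continuous_sig.surjective h.sig_tendsto ?_
  rw [show sig ρ k = fun x => -sig ρ k (-x) from funext fun x => by rw [h.sig_neg, neg_neg]]
  exact tendsto_neg_atTop_atBot.comp (h.sig_tendsto.comp tendsto_neg_atBot_atTop)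

/-- The increasing bijection `σ` of the line. -/
noncomputable def sigIso : ℝ ≃o ℝ := h.strictMono_sig.orderIsoOfSurjective _ h.surjective_sig

/-- The inverse `τ` of `σ`. -/
noncomputable def tau (y : ℝ) : ℝ := h.sigIso.symm y

theorem sig_tau (y : ℝ) : sig ρ k (h.tau y) = y := h.sigIso.apply_symm_apply y

theorem tau_sig (x : ℝ) : h.tau (sig ρ k x) = x := h.sigIso.symm_apply_apply x

theorem continuous_tau : Continuous h.tau := h.sigIso.symm.continuous

theorem hasDerivAt_tau (y : ℝ) : HasDerivAt h.tau (sigDeriv ρ k (h.tau y))⁻¹ y :=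
  HasDerivAt.of_local_left_inverse h.continuous_tau.continuousAt (h.hasDerivAt_sig _)
    (h.sigDeriv_pos _).ne' (Eventually.of_forall h.sig_tau)

theorem quasiMeasurePreserving_sig : Measure.QuasiMeasurePreserving (sig ρ k) :=
  quasiMeasurePreserving_of_leftInverse h.continuous_sig.measurable
    (fun y => (h.hasDerivAt_tau y).differentiableAt) h.tau_sig

theorem quasiMeasurePreserving_tau : Measure.QuasiMeasurePreserving h.tau :=
  quasiMeasurePreserving_of_leftInverse h.continuous_tau.measurable
    (fun x => (h.hasDerivAt_sig x).differentiableAt) h.sig_tau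

theorem liouvilleWeight_pos (x : ℝ) : 0 < liouvilleWeight ρ k x :=
  Real.sqrt_pos.2 (Real.sqrt_pos.2 (mul_pos (h.k_pos x) (h.rho_pos x)))

theorem liouvilleWeight_neg (x : ℝ) : liouvilleWeight ρ k (-x) = liouvilleWeight ρ k x := by
  simp only [liouvilleWeight, h.rho_even, h.k_even]

theorem continuous_liouvilleWeight : Continuous (liouvilleWeight ρ k) :=
  h.contDiff_mul.continuous.sqrt.sqrt

theorem rho_eq (x : ℝ) : ρ x = liouvilleWeight ρ k x ^ 2 * sigDeriv ρ k x := by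
  have hk := (h.k_pos x).ne'
  rw [liouvilleWeight_sq, sigDeriv, ← Real.sqrt_mul (mul_pos (h.k_pos x) (h.rho_pos x)).le,
    show k x * ρ x * (ρ x / k x) = ρ x ^ 2 by field_simp, Real.sqrt_sq (h.rho_pos x).le]

theorem hasDerivAt_liouvilleWeight (x : ℝ) : HasDerivAt (liouvilleWeight ρ k)
    (liouvilleWeight ρ k x * sigDeriv ρ k x * Q1 ρ k x) x := by
  have hP := mul_pos (h.k_pos x) (h.rho_pos x)
  have hm := (h.liouvilleWeight_pos x).ne'
  have hσ := (h.sigDeriv_pos x).ne'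
  have hfourth : k x * ρ x = liouvilleWeight ρ k x ^ 4 := by
    rw [← Real.sq_sqrt hP.le, ← liouvilleWeight_sq]
    ring
  have hderiv := ((h.contDiff_mul.differentiable one_ne_zero x).hasDerivAt.sqrt hP.ne').sqrt
    (Real.sqrt_pos.2 hP).ne'
  refine hderiv.congr_deriv ?_
  rw [Q1, sqrt_k_div_rho, ← liouvilleWeight_sq, Real.sqrt_sq (h.liouvilleWeight_pos x).le, hfourth]
  field_simp
  ring

theorem continuous_Q1 : Continuous (Q1 ρ k) :=
  ((h.continuous_k.div h.continuous_rho fun x => (h.rho_pos x).ne').sqrt.mul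
    (h.contDiff_mul.continuous_deriv le_rfl)).div (continuous_const.mul h.contDiff_mul.continuous)
    fun x => (mul_pos four_pos (mul_pos (h.k_pos x) (h.rho_pos x))).ne'

theorem Q1_neg (x : ℝ) : Q1 ρ k (-x) = -Q1 ρ k x := by
  have hderiv := deriv_comp_neg (fun y => k y * ρ y) x
  simp only [h.rho_even, h.k_even] at hderiv
  rw [Q1, Q1, hderiv, h.rho_even, h.k_even]
  ring

theorem Q1_zero : Q1 ρ k 0 = 0 := by
  have := h.Q1_neg 0
  rw [neg_zero] at this
  linarith

theorem isPrimitive_liouvilleWeight : IsPrimitive (liouvilleWeight ρ k)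
    fun x => liouvilleWeight ρ k x * sigDeriv ρ k x * Q1 ρ k x :=
  isPrimitive_of_hasDerivAt h.hasDerivAt_liouvilleWeight
    ((h.continuous_liouvilleWeight.mul h.continuous_sigDeriv).mul h.continuous_Q1)

theorem isPrimitive_inv_liouvilleWeight : IsPrimitive (fun x => (liouvilleWeight ρ k x)⁻¹)
    fun x => -(sigDeriv ρ k x * Q1 ρ k x * (liouvilleWeight ρ k x)⁻¹) := by
  have hm := fun x => (h.liouvilleWeight_pos x).ne'
  refine isPrimitive_of_hasDerivAt (fun x => ?_) ((h.continuous_sigDeriv.mul h.continuous_Q1).mul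
    (h.continuous_liouvilleWeight.inv₀ hm)).neg
  refine ((h.hasDerivAt_liouvilleWeight x).inv (hm x)).congr_deriv ?_
  have := hm x
  field_simp

theorem ae_rhoMeasure : ae (rhoMeasure ρ) = ae (volume : Measure ℝ) := by
  refine le_antisymm (withDensity_absolutelyContinuous _ _).ae_le (withDensity_absolutelyContinuous'
    h.continuous_rho.measurable.ennreal_ofReal.aemeasurable (ae_of_all _ fun x => ?_)).ae_le
  simpa using h.rho_pos x

theorem volume_absolutelyContinuous : volume ≪ rhoMeasure ρ :=
  Measure.ae_le_iff_absolutelyContinuous.1 h.ae_rhoMeasure.ge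

theorem integral_rhoMeasure (f : ℝ → ℝ) : ∫ x, f x ∂(rhoMeasure ρ) = ∫ x, ρ x * f x := by
  rw [rhoMeasure, integral_withDensity_eq_integral_toReal_smul
    h.continuous_rho.measurable.ennreal_ofReal (by simp)]
  simp only [ENNReal.toReal_ofReal (h.rho_pos _).le, smul_eq_mul]

theorem integrable_rhoMeasure_iff {f : ℝ → ℝ} :
    Integrable f (rhoMeasure ρ) ↔ Integrable fun x => ρ x * f x := by
  rw [rhoMeasure, integrable_withDensity_iff_integrable_smul'
    h.continuous_rho.measurable.ennreal_ofReal (by simp)]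
  simp only [ENNReal.toReal_ofReal (h.rho_pos _).le, smul_eq_mul]

theorem integral_comp_sig (f : ℝ → ℝ) : ∫ x, sigDeriv ρ k x * f (sig ρ k x) = ∫ y, f y := by
  have := integral_image_eq_integral_abs_deriv_smul MeasurableSet.univ
    (fun x _ => (h.hasDerivAt_sig x).hasDerivWithinAt) h.strictMono_sig.injective.injOn f
  simpa only [image_univ, h.surjective_sig.range_eq, Measure.restrict_univ,
    abs_of_pos (h.sigDeriv_pos _), smul_eq_mul] using this.symm

theorem integrable_comp_sig_iff {f : ℝ → ℝ} :
    Integrable (fun x => sigDeriv ρ k x * f (sig ρ k x)) ↔ Integrable f := by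
  have := integrableOn_image_iff_integrableOn_abs_deriv_smul MeasurableSet.univ
    (fun x _ => (h.hasDerivAt_sig x).hasDerivWithinAt) h.strictMono_sig.injective.injOn f
  simpa only [image_univ, h.surjective_sig.range_eq, integrableOn_univ,
    abs_of_pos (h.sigDeriv_pos _), smul_eq_mul] using this.symm

theorem tendsto_sig_zeroPlus :
    Tendsto (sig ρ k) (𝓝[>] 0 ⊓ ae volume) (𝓝[>] 0 ⊓ ae volume) := by
  refine Tendsto.inf (tendsto_nhdsWithin_iff.2 ⟨?_, ?_⟩) h.quasiMeasurePreserving_sig.tendsto_ae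
  · simpa only [sig_zero] using (h.continuous_sig.tendsto 0).mono_left nhdsWithin_le_nhds
  · filter_upwards [self_mem_nhdsWithin] with x hx
    simpa only [sig_zero, mem_Ioi] using h.strictMono_sig (show (0 : ℝ) < x from hx)

end LiouvilleCoefficients

/-! ### The Liouville transform -/

/-- `ψ`, as a function of `y = σ(x)`, represents the Liouville transform `m a` of `a`. -/
def IsLiouvilleTransform (ρ k : ℝ → ℝ) (a ψ : ℝ → ℝ) : Prop :=
  a =ᵐ[volume] fun x => ψ (sig ρ k x) * (liouvilleWeight ρ k x)⁻¹

theorem inner_L2rho (a b : L2rho ρ) : inner ℝ a b = ∫ x, a x * b x ∂(rhoMeasure ρ) := by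
  rw [L2.inner_def]
  exact integral_congr_ae (ae_of_all _ fun x => by simp [mul_comm])

namespace IsLiouvilleTransform

variable {a b ψ θ : ℝ → ℝ}

theorem sub (ha : IsLiouvilleTransform ρ k a ψ) (hb : IsLiouvilleTransform ρ k b θ) :
    IsLiouvilleTransform ρ k (fun x => a x - b x) (fun y => ψ y - θ y) := by
  filter_upwards [ha, hb] with x hax hbx
  rw [hax, hbx, sub_mul]

theorem rho_mul_mul (ha : IsLiouvilleTransform ρ k a ψ) (hb : IsLiouvilleTransform ρ k b θ)
    (h : LiouvilleCoefficients ρ k) : (fun x => ρ x * (a x * b x)) =ᵐ[volume]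
      fun x => sigDeriv ρ k x * (ψ (sig ρ k x) * θ (sig ρ k x)) := by
  filter_upwards [ha, hb] with x hax hbx
  have := (h.liouvilleWeight_pos x).ne'
  rw [hax, hbx, h.rho_eq]
  field_simp

theorem integral_mul (ha : IsLiouvilleTransform ρ k a ψ) (hb : IsLiouvilleTransform ρ k b θ)
    (h : LiouvilleCoefficients ρ k) : ∫ x, a x * b x ∂(rhoMeasure ρ) = ∫ y, ψ y * θ y := by
  rw [h.integral_rhoMeasure, integral_congr_ae (ha.rho_mul_mul hb h)]
  exact h.integral_comp_sig fun y => ψ y * θ y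

theorem integrable_mul_iff (ha : IsLiouvilleTransform ρ k a ψ) (hb : IsLiouvilleTransform ρ k b θ)
    (h : LiouvilleCoefficients ρ k) :
    Integrable (fun x => a x * b x) (rhoMeasure ρ) ↔ Integrable fun y => ψ y * θ y := by
  rw [h.integrable_rhoMeasure_iff, integrable_congr (ha.rho_mul_mul hb h)]
  exact h.integrable_comp_sig_iff (f := fun y => ψ y * θ y)

theorem ae_eq_comp_tau (ha : IsLiouvilleTransform ρ k a ψ) (h : LiouvilleCoefficients ρ k) :
    (fun y => a (h.tau y) * liouvilleWeight ρ k (h.tau y)) =ᵐ[volume] ψ := by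
  filter_upwards [h.quasiMeasurePreserving_tau.ae ha] with y hy
  rw [hy, h.sig_tau, inv_mul_cancel_right₀ (h.liouvilleWeight_pos _).ne']

theorem memLp {a : L2rho ρ} (ha : IsLiouvilleTransform ρ k a ψ) (h : LiouvilleCoefficients ρ k) :
    MemLp ψ 2 := by
  have hmeas : AEStronglyMeasurable ψ volume :=
    ((((Lp.aestronglyMeasurable a).mono_ac
      h.volume_absolutelyContinuous).comp_quasiMeasurePreserving h.quasiMeasurePreserving_tau).mul
      (h.continuous_liouvilleWeight.comp h.continuous_tau).aestronglyMeasurable).congr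
        (ha.ae_eq_comp_tau h)
  have hsq := (Lp.memLp a).integrable_sq
  simp only [memLp_two_iff_integrable_sq hmeas, sq] at hsq ⊢
  exact (ha.integrable_mul_iff ha h).1 hsq

theorem exists_of_memLp (hψ : MemLp ψ 2) (h : LiouvilleCoefficients ρ k) :
    ∃ a : L2rho ρ, IsLiouvilleTransform ρ k a ψ := by
  have hself : IsLiouvilleTransform ρ k
      (fun x => ψ (sig ρ k x) * (liouvilleWeight ρ k x)⁻¹) ψ := EventuallyEq.rfl
  have hmeas : AEStronglyMeasurable
      (fun x => ψ (sig ρ k x) * (liouvilleWeight ρ k x)⁻¹) (rhoMeasure ρ) :=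
    ((hψ.1.comp_quasiMeasurePreserving h.quasiMeasurePreserving_sig).mul
      (h.continuous_liouvilleWeight.inv₀ fun x =>
        (h.liouvilleWeight_pos x).ne').aestronglyMeasurable).mono_ac
          (withDensity_absolutelyContinuous _ _)
  have hsq := hψ.integrable_sq
  have hmem : MemLp (fun x => ψ (sig ρ k x) * (liouvilleWeight ρ k x)⁻¹) 2 (rhoMeasure ρ) := by
    simp only [memLp_two_iff_integrable_sq hmeas, sq] at hsq ⊢
    exact (hself.integrable_mul_iff hself h).2 hsq
  exact ⟨hmem.toLp _, h.volume_absolutelyContinuous.ae_eq hmem.coeFn_toLp⟩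

theorem inner_eq {a b : L2rho ρ} (ha : IsLiouvilleTransform ρ k a ψ)
    (hb : IsLiouvilleTransform ρ k b θ) (h : LiouvilleCoefficients ρ k) :
    inner ℝ a b = ∫ y, ψ y * θ y := by
  rw [inner_L2rho, ha.integral_mul hb h]

theorem norm_sq {a : L2rho ρ} (ha : IsLiouvilleTransform ρ k a ψ)
    (h : LiouvilleCoefficients ρ k) : ‖a‖ ^ 2 = ∫ y, ψ y ^ 2 := by
  rw [← real_inner_self_eq_norm_sq, ha.inner_eq ha h]
  simp only [sq]

theorem hasValueAtZeroPlus (ha : IsLiouvilleTransform ρ k a ψ) (h : LiouvilleCoefficients ρ k)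
    {c : ℝ} (hψ : HasValueAtZeroPlus ψ c) :
    HasValueAtZeroPlus a (c * (liouvilleWeight ρ k 0)⁻¹) := by
  have hweight : Tendsto (fun x => (liouvilleWeight ρ k x)⁻¹) (𝓝[>] 0 ⊓ ae volume)
      (𝓝 (liouvilleWeight ρ k 0)⁻¹) :=
    ((h.continuous_liouvilleWeight.inv₀ fun x => (h.liouvilleWeight_pos x).ne').tendsto 0).mono_left
      (inf_le_left.trans nhdsWithin_le_nhds)
  exact ((hψ.comp h.tendsto_sig_zeroPlus).mul hweight).congr'
    (EventuallyEq.filter_mono ha.symm inf_le_right)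

end IsLiouvilleTransform

/-- `ψ` and `ψ'`, as functions of `y = σ(x)`, represent the Liouville transforms of `φ` and `𝔻φ`,
with `ψ` the continuous representative. The transform thus turns `𝔻` into `d/dy`. -/
structure IsLift (φ : H1 ρ k) (ψ ψ' : ℝ → ℝ) : Prop where
  fst : IsLiouvilleTransform ρ k (fn φ) ψ
  snd : IsLiouvilleTransform ρ k (opD φ) ψ'
  isPrimitive : IsPrimitive ψ ψ'

theorem H1.norm_sq (φ : H1 ρ k) : ‖φ‖ ^ 2 = ‖fn φ‖ ^ 2 + ‖opD φ‖ ^ 2 :=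
  WithLp.prod_norm_sq_eq_of_L2 φ.1

theorem H1.exists_isPrimitive (φ : H1 ρ k) (h : LiouvilleCoefficients ρ k) :
    ∃ f f' : ℝ → ℝ, fn φ =ᵐ[volume] f ∧ IsPrimitive f f' ∧
      opD φ =ᵐ[volume] fun x => √(k x / ρ x) * f' x + Q1 ρ k x * f x := by
  obtain ⟨f, f', hfst, hweak, hsnd⟩ := φ.2
  obtain ⟨F, hF, hprim⟩ := hweak.exists_isPrimitive
  refine ⟨F, f', (h.volume_absolutelyContinuous.ae_eq hfst).trans hF, hprim, ?_⟩
  filter_upwards [h.volume_absolutelyContinuous.ae_eq hsnd, hF] with x hx hFx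
  rw [← hFx]
  exact hx

theorem H1.exists_isLift (φ : H1 ρ k) (h : LiouvilleCoefficients ρ k) :
    ∃ ψ ψ' : ℝ → ℝ, IsLift φ ψ ψ' := by
  obtain ⟨f, f', hfst, hprim, hsnd⟩ := H1.exists_isPrimitive φ h
  refine ⟨_, _, ?_, ?_, (hprim.mul h.isPrimitive_liouvilleWeight).comp h.hasDerivAt_tau
    fun y => (inv_pos.2 (h.sigDeriv_pos _)).le⟩
  · filter_upwards [hfst] with x hx
    have := (h.liouvilleWeight_pos x).ne'
    simp only [h.tau_sig, hx]
    field_simp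
  · filter_upwards [hsnd] with x hx
    have := (h.liouvilleWeight_pos x).ne'
    have := (h.sigDeriv_pos x).ne'
    simp only [h.tau_sig, hx, sqrt_k_div_rho]
    field_simp

theorem IsPrimitive.exists_isLift {ψ ψ' : ℝ → ℝ} (hprim : IsPrimitive ψ ψ') (hψ : MemLp ψ 2)
    (hψ' : MemLp ψ' 2) (h : LiouvilleCoefficients ρ k) : ∃ φ : H1 ρ k, IsLift φ ψ ψ' := by
  obtain ⟨a, ha⟩ := IsLiouvilleTransform.exists_of_memLp hψ h
  obtain ⟨b, hb⟩ := IsLiouvilleTransform.exists_of_memLp hψ' h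
  have hf := (hprim.comp h.hasDerivAt_sig fun x => (h.sigDeriv_pos x).le).mul
    h.isPrimitive_inv_liouvilleWeight
  refine ⟨⟨WithLp.toLp 2 (a, b), _, _, h.ae_rhoMeasure.le ha, hf.isWeakDerivOn,
    h.ae_rhoMeasure.le ?_⟩, ha, hb, hprim⟩
  filter_upwards [hb] with x hx
  have := (h.sigDeriv_pos x).ne'
  have := (h.liouvilleWeight_pos x).ne'
  change b x = _
  rw [hx, sqrt_k_div_rho]
  field_simp
  ring

namespace IsLift

variable {φ θ : H1 ρ k} {ψ ψ' ξ ξ' : ℝ → ℝ}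

theorem memLp_fst (hφ : IsLift φ ψ ψ') (h : LiouvilleCoefficients ρ k) : MemLp ψ 2 :=
  hφ.fst.memLp h

theorem memLp_snd (hφ : IsLift φ ψ ψ') (h : LiouvilleCoefficients ρ k) : MemLp ψ' 2 :=
  hφ.snd.memLp h

theorem norm_sq (hφ : IsLift φ ψ ψ') (h : LiouvilleCoefficients ρ k) :
    ‖φ‖ ^ 2 = (∫ y, ψ y ^ 2) + ∫ y, ψ' y ^ 2 := by
  rw [H1.norm_sq, hφ.fst.norm_sq h, hφ.snd.norm_sq h]

theorem sub (hφ : IsLift φ ψ ψ') (hθ : IsLift θ ξ ξ') (h : LiouvilleCoefficients ρ k) :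
    IsLift (φ - θ) (fun y => ψ y - ξ y) (fun y => ψ' y - ξ' y) where
  fst := (h.volume_absolutelyContinuous.ae_eq (Lp.coeFn_sub (fn φ) (fn θ))).trans
    (hφ.fst.sub hθ.fst)
  snd := (h.volume_absolutelyContinuous.ae_eq (Lp.coeFn_sub (opD φ) (opD θ))).trans
    (hφ.snd.sub hθ.snd)
  isPrimitive := by simpa only [neg_one_mul, ← sub_eq_add_neg] using
    hφ.isPrimitive.add (hθ.isPrimitive.const_mul (-1))

theorem valueAtZero_eq (hφ : IsLift φ ψ ψ') (h : LiouvilleCoefficients ρ k) :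
    valueAtZero (fn φ) = ψ 0 * (liouvilleWeight ρ k 0)⁻¹ := by
  rw [HalfAxisHeat.valueAtZero_eq hφ.fst, sig_zero]
  exact ((hφ.isPrimitive.continuous.comp h.continuous_sig).mul
    (h.continuous_liouvilleWeight.inv₀ fun x => (h.liouvilleWeight_pos x).ne')).continuousAt

theorem even (hφ : IsLift φ ψ ψ') (h : LiouvilleCoefficients ρ k) (he : IsEven φ) (y : ℝ) :
    ψ (-y) = ψ y := by
  have hx : ∀ᵐ x, ψ (-sig ρ k x) = ψ (sig ρ k x) := by
    filter_upwards [he, hφ.fst, (Measure.measurePreserving_neg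
      (volume : Measure ℝ)).quasiMeasurePreserving.ae hφ.fst] with x hex hφx hφnx
    rw [hφx, hφnx, h.sig_neg, h.liouvilleWeight_neg] at hex
    exact mul_right_cancel₀ (inv_ne_zero (h.liouvilleWeight_pos x).ne') hex
  have hy : (fun y => ψ (-y)) =ᵐ[volume] ψ := by
    filter_upwards [h.quasiMeasurePreserving_tau.ae hx] with y hy
    rwa [h.sig_tau] at hy
  have hc := hφ.isPrimitive.continuous
  exact congrFun (((hc.comp continuous_neg).ae_eq_iff_eq volume hc).1 hy) y

theorem isEven (hφ : IsLift φ ψ ψ') (h : LiouvilleCoefficients ρ k)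
    (he : ∀ y, ψ (-y) = ψ y) : IsEven φ := by
  filter_upwards [hφ.fst, (Measure.measurePreserving_neg
    (volume : Measure ℝ)).quasiMeasurePreserving.ae hφ.fst] with x hφx hφnx
  rw [hφx, hφnx, h.sig_neg, h.liouvilleWeight_neg, he]

end IsLift

/-! ### The heat kernel -/

/-- The heat kernel `(4πs)^{-1/2} exp(-y²/(4s))` of the line at time `s > 0`. -/
noncomputable def heatKernel (s y : ℝ) : ℝ :=
  (Real.sqrt (4 * Real.pi * s))⁻¹ * Real.exp (-(y ^ 2) / (4 * s))

/-- The first space derivative of `heatKernel`. -/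
noncomputable def heatKernelDeriv (s y : ℝ) : ℝ :=
  -(y / (2 * s)) * heatKernel s y

/-- The second space derivative of `heatKernel`, which is also its time derivative. -/
noncomputable def heatKernelDeriv2 (s y : ℝ) : ℝ :=
  (y ^ 2 / (4 * s ^ 2) - 1 / (2 * s)) * heatKernel s y

/-- The third space derivative of `heatKernel`, which is also the time derivative of
`heatKernelDeriv`. -/
noncomputable def heatKernelDeriv3 (s y : ℝ) : ℝ :=
  (-(y ^ 3 / (8 * s ^ 3)) + 3 * y / (4 * s ^ 2)) * heatKernel s y

theorem heatKernel_nonneg (s y : ℝ) : 0 ≤ heatKernel s y := by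
  unfold heatKernel
  positivity

theorem heatKernel_neg (s y : ℝ) : heatKernel s (-y) = heatKernel s y := by
  simp [heatKernel]

theorem hasDerivAt_heatKernel {s : ℝ} (hs : s ≠ 0) (y : ℝ) :
    HasDerivAt (heatKernel s) (heatKernelDeriv s y) y := by
  have hexponent : HasDerivAt (fun y : ℝ => -(y ^ 2) / (4 * s)) (-(2 * y) / (4 * s)) y := by
    simpa using ((hasDerivAt_pow 2 y).neg).div_const (4 * s)
  refine (hexponent.exp.const_mul _).congr_deriv ?_
  unfold heatKernelDeriv heatKernel
  field_simp
  ring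

theorem hasDerivAt_heatKernelDeriv {s : ℝ} (hs : s ≠ 0) (y : ℝ) :
    HasDerivAt (heatKernelDeriv s) (heatKernelDeriv2 s y) y := by
  have hfactor : HasDerivAt (fun y : ℝ => -(y / (2 * s))) (-(1 / (2 * s))) y :=
    ((hasDerivAt_id y).div_const _).neg
  refine (hfactor.mul (hasDerivAt_heatKernel hs y)).congr_deriv ?_
  unfold heatKernelDeriv2 heatKernelDeriv
  field_simp
  ring

theorem hasDerivAt_heatKernelDeriv2 {s : ℝ} (hs : s ≠ 0) (y : ℝ) :
    HasDerivAt (heatKernelDeriv2 s) (heatKernelDeriv3 s y) y := by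
  have hfactor : HasDerivAt (fun y : ℝ => y ^ 2 / (4 * s ^ 2) - 1 / (2 * s))
      (2 * y / (4 * s ^ 2)) y := by
    simpa using ((hasDerivAt_pow 2 y).div_const (4 * s ^ 2)).sub_const (1 / (2 * s))
  refine (hfactor.mul (hasDerivAt_heatKernel hs y)).congr_deriv ?_
  unfold heatKernelDeriv3 heatKernelDeriv
  field_simp
  ring

theorem hasDerivAt_heatKernel_time {s : ℝ} (hs : 0 < s) (y : ℝ) :
    HasDerivAt (fun s => heatKernel s y) (heatKernelDeriv2 s y) s := by
  have hexponent : HasDerivAt (fun s : ℝ => -(y ^ 2) / (4 * s)) (y ^ 2 / (4 * s ^ 2)) s := by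
    refine ((hasDerivAt_const s (-(y ^ 2))).div ((hasDerivAt_id s).const_mul 4)
      (by simp only [id]; positivity)).congr_deriv ?_
    simp only [id]
    field_simp
    ring
  have hfactor : HasDerivAt (fun s : ℝ => (Real.sqrt (4 * Real.pi * s))⁻¹)
      (-(1 / (2 * s)) * (Real.sqrt (4 * Real.pi * s))⁻¹) s := by
    refine (((hasDerivAt_id s).const_mul (4 * Real.pi)).sqrt
      (by simp only [id]; positivity)).inv (by simp only [id]; positivity) |>.congr_deriv ?_
    simp only [id]
    rw [Real.sq_sqrt (by positivity)]
    field_simp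
  refine (hfactor.mul hexponent.exp).congr_deriv ?_
  unfold heatKernelDeriv2 heatKernel
  ring

theorem hasDerivAt_heatKernelDeriv_time {s : ℝ} (hs : 0 < s) (y : ℝ) :
    HasDerivAt (fun s => heatKernelDeriv s y) (heatKernelDeriv3 s y) s := by
  have hfactor : HasDerivAt (fun s : ℝ => -(y / (2 * s))) (y / (2 * s ^ 2)) s := by
    refine ((hasDerivAt_const s y).div ((hasDerivAt_id s).const_mul 2)
      (by simp only [id]; positivity)).neg.congr_deriv ?_
    simp only [id]
    field_simp
    ring
  refine (hfactor.mul (hasDerivAt_heatKernel_time hs y)).congr_deriv ?_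
  unfold heatKernelDeriv3 heatKernelDeriv2
  field_simp
  ring

theorem continuous_heatKernel {s : ℝ} (hs : s ≠ 0) : Continuous (heatKernel s) :=
  continuous_iff_continuousAt.2 fun y => (hasDerivAt_heatKernel hs y).continuousAt

theorem continuous_heatKernelDeriv {s : ℝ} (hs : s ≠ 0) : Continuous (heatKernelDeriv s) :=
  continuous_iff_continuousAt.2 fun y => (hasDerivAt_heatKernelDeriv hs y).continuousAt

theorem continuous_heatKernelDeriv2 {s : ℝ} (hs : s ≠ 0) : Continuous (heatKernelDeriv2 s) :=
  continuous_iff_continuousAt.2 fun y => (hasDerivAt_heatKernelDeriv2 hs y).continuousAt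

/-! ### Uniformly decaying kernels -/

/-- A family `K s` of functions on the line with `|K s y| ≤ C / (1 + y ^ 2)` for `s ∈ I`, with one
constant `C`: the class in which the heat kernel and its derivatives stay over compact sets of
positive times. -/
def DecaysUniformlyOn (I : Set ℝ) (K : ℝ → ℝ → ℝ) : Prop :=
  ∃ C, ∀ s ∈ I, ∀ y, |K s y| ≤ C * (1 + y ^ 2)⁻¹

theorem memLp_inv_one_add_sq : MemLp (fun y : ℝ => (1 + y ^ 2)⁻¹) 2 := by
  have hc : Continuous fun y : ℝ => (1 + y ^ 2)⁻¹ :=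
    (continuous_const.add (continuous_id.pow 2)).inv₀ fun y =>
      (by positivity : (0 : ℝ) < 1 + y ^ 2).ne'
  rw [memLp_two_iff_integrable_sq hc.aestronglyMeasurable]
  refine integrable_inv_one_add_sq.mono' (hc.pow 2).aestronglyMeasurable (ae_of_all _ fun y => ?_)
  rw [Real.norm_of_nonneg (by positivity), sq]
  exact mul_le_of_le_one_left (by positivity)
    (inv_le_one_of_one_le₀ (le_add_of_nonneg_right (sq_nonneg y)))

theorem inv_one_add_sub_sq_le (y c : ℝ) :
    (1 + (y - c) ^ 2)⁻¹ ≤ 2 * (1 + c ^ 2) * (1 + y ^ 2)⁻¹ := by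
  rw [← div_eq_mul_inv, inv_le_iff_one_le_mul₀ (by positivity), div_mul_eq_mul_div,
    le_div_iff₀ (by positivity)]
  nlinarith [sq_nonneg (y - 2 * c), sq_nonneg (c * (y - c))]

namespace DecaysUniformlyOn

variable {I : Set ℝ} {K K' : ℝ → ℝ → ℝ}

theorem add (hK : DecaysUniformlyOn I K) (hK' : DecaysUniformlyOn I K') :
    DecaysUniformlyOn I fun s y => K s y + K' s y := by
  obtain ⟨C, hC⟩ := hK
  obtain ⟨C', hC'⟩ := hK'
  refine ⟨C + C', fun s hs y => (abs_add_le _ _).trans ?_⟩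
  rw [add_mul]
  exact add_le_add (hC s hs y) (hC' s hs y)

theorem mul_left {c : ℝ → ℝ} (hK : DecaysUniformlyOn I K) (hI : IsCompact I)
    (hc : ContinuousOn c I) : DecaysUniformlyOn I fun s y => c s * K s y := by
  obtain ⟨C, hC⟩ := hK
  obtain ⟨M, hM⟩ := hI.exists_bound_of_continuousOn hc
  refine ⟨M * C, fun s hs y => ?_⟩
  rw [abs_mul, mul_assoc]
  exact mul_le_mul (hM s hs) (hC s hs y) (abs_nonneg _) ((norm_nonneg _).trans (hM s hs))

theorem comp_sub (hK : DecaysUniformlyOn I K) (c : ℝ) :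
    DecaysUniformlyOn I fun s y => K s (y - c) := by
  obtain ⟨C, hC⟩ := hK
  refine ⟨C * (2 * (1 + c ^ 2)), fun s hs y => (hC s hs _).trans ?_⟩
  have hC0 : 0 ≤ C := by simpa using (abs_nonneg _).trans (hC s hs 0)
  rw [mul_assoc]
  exact mul_le_mul_of_nonneg_left (inv_one_add_sub_sq_le y c) hC0

theorem memLp (hK : DecaysUniformlyOn I K) {s : ℝ} (hs : s ∈ I) (hc : Continuous (K s)) :
    MemLp (K s) 2 := by
  obtain ⟨C, hC⟩ := hK
  exact (memLp_inv_one_add_sq.const_mul C).mono' hc.aestronglyMeasurable (ae_of_all _ (hC s hs))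

theorem hasDerivAt_integral_mul (hK' : DecaysUniformlyOn I K') {s : ℝ} (hI : I ∈ 𝓝 s)
    (hd : ∀ r ∈ I, ∀ y, HasDerivAt (fun r => K r y) (K' r y) r) (hLp : ∀ r ∈ I, MemLp (K r) 2)
    (hc' : Continuous (K' s)) {g : ℝ → ℝ} (hg : MemLp g 2) :
    HasDerivAt (fun r => ∫ y, g y * K r y) (∫ y, g y * K' s y) s := by
  have hs := mem_of_mem_nhds hI
  have hLp' := hK'.memLp hs hc'
  obtain ⟨C, hC⟩ := hK'
  refine (hasDerivAt_integral_of_dominated_loc_of_deriv_le hI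
    (bound := fun y => |g y| * (C * (1 + y ^ 2)⁻¹)) (F := fun s y => g y * K s y)
    (F' := fun s y => g y * K' s y) ?_ (MemLp.integrable_mul hg (hLp s hs))
    (MemLp.integrable_mul hg hLp').aestronglyMeasurable
    (ae_of_all _ fun y r hr => ?_) (MemLp.integrable_mul hg.norm (memLp_inv_one_add_sq.const_mul C))
    (ae_of_all _ fun y r hr => (hd r hr y).const_mul _)).2
  · filter_upwards [hI] with r hr
    exact (MemLp.integrable_mul hg (hLp r hr)).aestronglyMeasurable
  · rw [norm_mul, Real.norm_eq_abs]
    exact mul_le_mul_of_nonneg_left (hC r hr y) (abs_nonneg _)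

theorem exists_integral_sub_sq_le (hK' : DecaysUniformlyOn I K') (hI : Convex ℝ I)
    (hd : ∀ r ∈ I, ∀ y, HasDerivAt (fun r => K r y) (K' r y) r) :
    ∃ L, ∀ s ∈ I, ∀ r ∈ I, ∫ y, (K s y - K r y) ^ 2 ≤ L * |s - r| ^ 2 := by
  obtain ⟨C, hC⟩ := hK'
  refine ⟨∫ y : ℝ, (C * (1 + y ^ 2)⁻¹) ^ 2, fun s hs r hr => ?_⟩
  rw [← integral_mul_const]
  refine integral_mono_of_nonneg (ae_of_all _ fun y => sq_nonneg _)
    ((memLp_inv_one_add_sq.const_mul C).integrable_sq.mul_const _) (ae_of_all _ fun y => ?_)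
  have hmean := hI.norm_image_sub_le_of_norm_hasDerivWithin_le (f := fun s => K s y)
    (fun x hx => (hd x hx y).hasDerivWithinAt) (fun x hx => hC x hx y) hr hs
  simpa only [Real.norm_eq_abs, sq_abs, mul_pow] using
    pow_le_pow_left₀ (abs_nonneg _) hmean 2

end DecaysUniformlyOn

theorem one_add_sq_pow_mul_exp_le {S : ℝ} (hS : 0 < S) (n : ℕ) (y : ℝ) :
    (1 + y ^ 2) ^ n * Real.exp (-(y ^ 2) / (4 * S)) ≤
      (4 * S) ^ n * n.factorial * Real.exp (1 / (4 * S)) := by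
  have hpow : ((1 + y ^ 2) / (4 * S)) ^ n ≤ n.factorial * Real.exp ((1 + y ^ 2) / (4 * S)) := by
    rw [← div_le_iff₀' (by positivity)]
    exact Real.pow_div_factorial_le_exp _ (by positivity) n
  have hexp : Real.exp (1 / (4 * S)) =
      Real.exp ((1 + y ^ 2) / (4 * S)) * Real.exp (-(y ^ 2) / (4 * S)) := by
    rw [← Real.exp_add]
    congr 1
    ring
  rw [div_pow, div_le_iff₀ (by positivity)] at hpow
  rw [hexp]
  calc (1 + y ^ 2) ^ n * Real.exp (-(y ^ 2) / (4 * S))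
      ≤ n.factorial * Real.exp ((1 + y ^ 2) / (4 * S)) * (4 * S) ^ n *
          Real.exp (-(y ^ 2) / (4 * S)) := by gcongr
    _ = _ := by ring

theorem decaysUniformlyOn_pow_mul_heatKernel {ε S : ℝ} (hε : 0 < ε) (n : ℕ) :
    DecaysUniformlyOn (Icc ε S) fun s y => y ^ n * heatKernel s y := by
  refine ⟨(Real.sqrt (4 * Real.pi * ε))⁻¹ *
    ((4 * S) ^ (n + 1) * (n + 1).factorial * Real.exp (1 / (4 * S))), fun s hs y => ?_⟩
  have hs0 : 0 < s := hε.trans_le hs.1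
  have hS : 0 < S := hs0.trans_le hs.2
  have hkernel : heatKernel s y ≤
      (Real.sqrt (4 * Real.pi * ε))⁻¹ * Real.exp (-(y ^ 2) / (4 * S)) := by
    unfold heatKernel
    gcongr ?_ * Real.exp ?_
    · gcongr
      exact hs.1
    · rw [neg_div, neg_div, neg_le_neg_iff]
      gcongr
      exact hs.2
  have habs : |y| ≤ 1 + y ^ 2 := by nlinarith [sq_nonneg (|y| - 1), sq_abs y]
  rw [abs_mul, abs_pow, abs_of_nonneg (heatKernel_nonneg s y), ← div_eq_mul_inv,
    le_div_iff₀ (by positivity)]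
  calc |y| ^ n * heatKernel s y * (1 + y ^ 2)
      ≤ (1 + y ^ 2) ^ n * ((Real.sqrt (4 * Real.pi * ε))⁻¹ * Real.exp (-(y ^ 2) / (4 * S))) *
          (1 + y ^ 2) := by
        gcongr
        exact heatKernel_nonneg s y
    _ = (Real.sqrt (4 * Real.pi * ε))⁻¹ *
          ((1 + y ^ 2) ^ (n + 1) * Real.exp (-(y ^ 2) / (4 * S))) := by ring
    _ ≤ _ := by gcongr ?_ * ?_; exact one_add_sq_pow_mul_exp_le hS (n + 1) y

section

variable {ε : ℝ} (hε : 0 < ε) (S : ℝ)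

include hε

theorem continuousOn_div_pow (c : ℝ) (n : ℕ) : ContinuousOn (fun s : ℝ => c / s ^ n) (Icc ε S) :=
  continuousOn_const.div (continuousOn_id.pow n) fun _ hs => pow_ne_zero n (hε.trans_le hs.1).ne'

theorem decaysUniformlyOn_div_pow_mul_pow_mul_heatKernel (c : ℝ) (m n : ℕ) :
    DecaysUniformlyOn (Icc ε S) fun s y => c / s ^ m * (y ^ n * heatKernel s y) :=
  (decaysUniformlyOn_pow_mul_heatKernel hε n).mul_left isCompact_Icc (continuousOn_div_pow hε S c m)

theorem decaysUniformlyOn_heatKernel : DecaysUniformlyOn (Icc ε S) heatKernel := by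
  simpa only [pow_zero, one_mul] using decaysUniformlyOn_pow_mul_heatKernel (S := S) hε 0

theorem decaysUniformlyOn_heatKernelDeriv : DecaysUniformlyOn (Icc ε S) heatKernelDeriv := by
  convert decaysUniformlyOn_div_pow_mul_pow_mul_heatKernel hε S (-1 / 2) 1 1 using 3 with s y
  unfold heatKernelDeriv
  ring

theorem decaysUniformlyOn_heatKernelDeriv2 : DecaysUniformlyOn (Icc ε S) heatKernelDeriv2 := by
  convert (decaysUniformlyOn_div_pow_mul_pow_mul_heatKernel hε S (1 / 4) 2 2).add
    (decaysUniformlyOn_div_pow_mul_pow_mul_heatKernel hε S (-1 / 2) 1 0) using 3 with s y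
  unfold heatKernelDeriv2
  ring

theorem decaysUniformlyOn_heatKernelDeriv3 : DecaysUniformlyOn (Icc ε S) heatKernelDeriv3 := by
  convert (decaysUniformlyOn_div_pow_mul_pow_mul_heatKernel hε S (-1 / 8) 3 3).add
    (decaysUniformlyOn_div_pow_mul_pow_mul_heatKernel hε S (3 / 4) 2 1) using 3 with s y
  unfold heatKernelDeriv3
  ring

end

theorem memLp_heatKernel_comp_sub {s : ℝ} (hs : 0 < s) (c : ℝ) :
    MemLp (fun y => heatKernel s (y - c)) 2 :=
  ((decaysUniformlyOn_heatKernel hs s).memLp (left_mem_Icc.2 le_rfl)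
    (continuous_heatKernel hs.ne')).comp_measurePreserving (measurePreserving_sub_right volume c)

theorem integral_heatKernel_mul_heatKernel {s : ℝ} (hs : 0 < s) (a b : ℝ) :
    ∫ y, heatKernel s (y - a) * heatKernel s (y - b) =
      (Real.sqrt (8 * Real.pi * s))⁻¹ * Real.exp (-((a - b) ^ 2) / (8 * s)) := by
  have hprod : ∀ y, heatKernel s (y - a) * heatKernel s (y - b) = (4 * Real.pi * s)⁻¹ *
      Real.exp (-((a - b) ^ 2) / (8 * s)) *
        Real.exp (-(1 / (2 * s)) * (y - (a + b) / 2) ^ 2) := by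
    intro y
    have hsq : (Real.sqrt (4 * Real.pi * s))⁻¹ * (Real.sqrt (4 * Real.pi * s))⁻¹ =
        (4 * Real.pi * s)⁻¹ := by
      rw [← mul_inv, Real.mul_self_sqrt (by positivity)]
    unfold heatKernel
    rw [mul_mul_mul_comm, hsq, mul_assoc (4 * Real.pi * s)⁻¹, ← Real.exp_add, ← Real.exp_add]
    congr 2
    field_simp
    ring
  have hsqrt : Real.sqrt (Real.pi / (1 / (2 * s))) =
      (4 * Real.pi * s) / Real.sqrt (8 * Real.pi * s) := by
    rw [eq_div_iff (by positivity), ← Real.sqrt_mul (by positivity),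
      show Real.pi / (1 / (2 * s)) * (8 * Real.pi * s) = (4 * Real.pi * s) ^ 2 by field_simp; ring]
    exact Real.sqrt_sq (by positivity)
  simp_rw [hprod]
  rw [integral_const_mul, integral_sub_right_eq_self
    (fun y => Real.exp (-(1 / (2 * s)) * y ^ 2)), integral_gaussian, hsqrt]
  field_simp

theorem integral_heatKernel : ∫ y, heatKernel 1 y = 1 := by
  have hgauss : ∀ y, heatKernel 1 y =
      (Real.sqrt (4 * Real.pi))⁻¹ * Real.exp (-(1 / 4) * y ^ 2) := by
    intro y
    unfold heatKernel
    rw [mul_one]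
    congr 2
    ring
  simp_rw [hgauss]
  rw [integral_const_mul, integral_gaussian, show Real.pi / (1 / 4) = 4 * Real.pi by ring]
  exact inv_mul_cancel₀ (Real.sqrt_pos.2 (by positivity)).ne'

theorem integrable_heatKernel : Integrable (heatKernel 1) :=
  Integrable.of_integral_ne_zero (integral_heatKernel.trans_ne one_ne_zero)

theorem heatKernel_sqrt_mul {s : ℝ} (hs : 0 < s) (w : ℝ) :
    heatKernel s (Real.sqrt s * w) = (Real.sqrt s)⁻¹ * heatKernel 1 w := by
  unfold heatKernel
  rw [Real.sqrt_mul (by positivity), mul_one, mul_pow, Real.sq_sqrt hs.le,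
    show -(s * w ^ 2) / (4 * s) = -(w ^ 2) / (4 * 1) by field_simp]
  field_simp

theorem integral_mul_heatKernel (g : ℝ → ℝ) {s : ℝ} (hs : 0 < s) (z : ℝ) :
    ∫ y, g y * heatKernel s (y - z) = ∫ w, g (z + Real.sqrt s * w) * heatKernel 1 w := by
  have hscale := Measure.integral_comp_mul_left
    (fun y => g (z + y) * heatKernel s y) (Real.sqrt s)
  have hshift := integral_sub_right_eq_self (fun y => g (z + y) * heatKernel s y) z (μ := volume)
  simp only [add_sub_cancel] at hshift
  have hpos : 0 < (Real.sqrt s)⁻¹ := by positivity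
  simp_rw [heatKernel_sqrt_mul hs, mul_left_comm _ (Real.sqrt s)⁻¹] at hscale
  rw [integral_const_mul, abs_of_pos hpos, smul_eq_mul] at hscale
  rw [hshift, mul_left_cancel₀ hpos.ne' hscale]

theorem tendsto_integral_mul_heatKernel {g : ℝ → ℝ} (hc : Continuous g) {B : ℝ}
    (hB : ∀ y, |g y| ≤ B) (z : ℝ) :
    Tendsto (fun s => ∫ y, g y * heatKernel s (y - z)) (𝓝[>] 0) (𝓝 (g z)) := by
  have hlim : Tendsto (fun s => ∫ w, g (z + Real.sqrt s * w) * heatKernel 1 w) (𝓝[>] 0)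
      (𝓝 (∫ w, g z * heatKernel 1 w)) := by
    refine tendsto_integral_filter_of_dominated_convergence (fun w => B * heatKernel 1 w)
      (Eventually.of_forall fun s => ((hc.comp (by fun_prop)).mul
        (continuous_heatKernel one_ne_zero)).aestronglyMeasurable)
      (Eventually.of_forall fun s => ae_of_all _ fun w => ?_)
      (integrable_heatKernel.const_mul B) (ae_of_all _ fun w => Tendsto.mul_const _ ?_)
    · rw [norm_mul, Real.norm_of_nonneg (heatKernel_nonneg _ _)]
      exact mul_le_mul_of_nonneg_right (hB _) (heatKernel_nonneg _ _)
    · have hcont : Continuous fun s : ℝ => g (z + Real.sqrt s * w) := hc.comp (by fun_prop)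
      simpa using (hcont.tendsto 0).mono_left nhdsWithin_le_nhds
  rw [integral_const_mul, integral_heatKernel, mul_one] at hlim
  refine hlim.congr' ?_
  filter_upwards [self_mem_nhdsWithin] with s hs
  exact (integral_mul_heatKernel g hs z).symm

/-! ### Differences of two translates -/

/-- The difference of the translates of `K s` centred at `b` and at `a`. -/
def translateDiff (a b : ℝ) (K : ℝ → ℝ → ℝ) (s y : ℝ) : ℝ := K s (y - b) - K s (y - a)

section

variable {a b : ℝ} {K K' : ℝ → ℝ → ℝ}

theorem DecaysUniformlyOn.translateDiff {I : Set ℝ} (hK : DecaysUniformlyOn I K) :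
    DecaysUniformlyOn I (translateDiff a b K) := by
  obtain ⟨Cb, hCb⟩ := hK.comp_sub b
  obtain ⟨Ca, hCa⟩ := hK.comp_sub a
  refine ⟨Cb + Ca, fun s hs y => (abs_sub _ _).trans ?_⟩
  rw [add_mul]
  exact add_le_add (hCb s hs y) (hCa s hs y)

theorem continuous_translateDiff {s : ℝ} (hc : Continuous (K s)) :
    Continuous (translateDiff a b K s) :=
  (hc.comp (continuous_sub_right b)).sub (hc.comp (continuous_sub_right a))

theorem hasDerivAt_translateDiff {s : ℝ} (hd : ∀ y, HasDerivAt (K s) (K' s y) y) (y : ℝ) :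
    HasDerivAt (translateDiff a b K s) (translateDiff a b K' s y) y :=
  ((hd _).comp_sub_const y b).sub ((hd _).comp_sub_const y a)

theorem hasDerivAt_translateDiff_time {s : ℝ}
    (hd : ∀ y, HasDerivAt (fun r => K r y) (K' s y) s) (y : ℝ) :
    HasDerivAt (fun r => translateDiff a b K r y) (translateDiff a b K' s y) s :=
  (hd _).sub (hd _)

end

theorem integral_translateDiff_heatKernel_sq_le {s : ℝ} (hs : 0 < s) (a b : ℝ) :
    ∫ y, translateDiff a b heatKernel s y ^ 2 ≤ ((b - a) * s ^ (-(3 / 4) : ℝ)) ^ 2 := by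
  have hi : ∀ p q, Integrable fun y => heatKernel s (y - p) * heatKernel s (y - q) := fun p q =>
    MemLp.integrable_mul (memLp_heatKernel_comp_sub hs p) (memLp_heatKernel_comp_sub hs q)
  have hexp : 1 - Real.exp (-((a - b) ^ 2) / (8 * s)) ≤ (b - a) ^ 2 / (8 * s) := by
    have := Real.add_one_le_exp (-((a - b) ^ 2) / (8 * s))
    rw [show -((a - b) ^ 2) / (8 * s) = -((b - a) ^ 2 / (8 * s)) by ring] at this ⊢
    linarith
  have hsqrt : (Real.sqrt (8 * Real.pi * s))⁻¹ ≤ s ^ (-(1 / 2) : ℝ) := by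
    rw [Real.rpow_neg hs.le, ← Real.sqrt_eq_rpow]
    gcongr
    nlinarith [Real.pi_gt_three]
  have hrpow : (s ^ (-(3 / 4) : ℝ)) ^ 2 = s ^ (-(1 / 2) : ℝ) * s⁻¹ := by
    rw [← Real.rpow_natCast, ← Real.rpow_mul hs.le, ← Real.rpow_neg_one s, ← Real.rpow_add hs]
    norm_num
  calc ∫ y, translateDiff a b heatKernel s y ^ 2
      = ∫ y, (heatKernel s (y - b) * heatKernel s (y - b)
          - 2 * (heatKernel s (y - a) * heatKernel s (y - b))
          + heatKernel s (y - a) * heatKernel s (y - a)) := by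
        congr with y
        unfold translateDiff
        ring
    _ = 2 * (Real.sqrt (8 * Real.pi * s))⁻¹ * (1 - Real.exp (-((a - b) ^ 2) / (8 * s))) := by
        rw [integral_add ((hi b b).sub' ((hi a b).const_mul 2)) (hi a a),
          integral_sub (hi b b) ((hi a b).const_mul 2), integral_const_mul]
        simp only [integral_heatKernel_mul_heatKernel hs, sub_self, ne_eq, OfNat.ofNat_ne_zero,
          not_false_eq_true, zero_pow, neg_zero, zero_div, Real.exp_zero, mul_one]
        ring
    _ ≤ 2 * s ^ (-(1 / 2) : ℝ) * ((b - a) ^ 2 / (8 * s)) := by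
        gcongr
        exact sub_nonneg.2 (Real.exp_le_one_iff.2
          (div_nonpos_of_nonpos_of_nonneg (neg_nonpos.2 (sq_nonneg _)) (by positivity)))
    _ = 1 / 4 * ((b - a) * s ^ (-(3 / 4) : ℝ)) ^ 2 := by
        rw [mul_pow, hrpow]
        ring
    _ ≤ _ := mul_le_of_le_one_left (sq_nonneg _) (by norm_num)

/-- A majorant, up to a constant, of `-heatKernelDeriv s` on `[a, 2a]`. It has bounded mass in
`s ∈ (0, ∞)` which concentrates at `s = 0` as `a → 0`. -/
noncomputable def boundaryMajorant (a s : ℝ) : ℝ := a / ((a ^ 2 + s) * Real.sqrt (a ^ 2 + s))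

theorem add_mul_sqrt_add_le {a s : ℝ} (hs : 0 < s) :
    (a ^ 2 + s) * Real.sqrt (a ^ 2 + s) ≤
      32 * (s * Real.sqrt s * Real.exp (a ^ 2 / (4 * s))) := by
  obtain ⟨r, hr⟩ : ∃ r, r = a ^ 2 / s := ⟨_, rfl⟩
  have hr0 : 0 ≤ r := hr ▸ by positivity
  have hsum : a ^ 2 + s = s * (1 + r) := by
    rw [hr]
    field_simp
    ring
  have hsqrt : Real.sqrt (1 + r) ≤ 1 + r := by
    rw [Real.sqrt_le_left (by positivity)]
    nlinarith
  have hexp : (1 + r) ^ 2 ≤ 32 * Real.exp (r / 4) := by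
    nlinarith [Real.quadratic_le_exp_of_nonneg (x := r / 4) (by positivity)]
  calc (a ^ 2 + s) * Real.sqrt (a ^ 2 + s)
      = s * Real.sqrt s * ((1 + r) * Real.sqrt (1 + r)) := by
        rw [hsum, Real.sqrt_mul hs.le]
        ring
    _ ≤ s * Real.sqrt s * ((1 + r) * (1 + r)) := by gcongr
    _ ≤ s * Real.sqrt s * (32 * Real.exp (r / 4)) := by
        rw [← sq]
        gcongr
    _ = _ := by
        rw [hr, div_div, mul_comm s 4]
        ring

theorem abs_heatKernelDeriv_le {s a y : ℝ} (hs : 0 < s) (ha : 0 < a) (hay : a ≤ y)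
    (hy : y ≤ 2 * a) : |heatKernelDeriv s y| ≤ 32 * boundaryMajorant a s := by
  have hy0 : 0 < y := ha.trans_le hay
  have hkernel : heatKernel s y ≤ (Real.sqrt s * Real.exp (a ^ 2 / (4 * s)))⁻¹ := by
    unfold heatKernel
    rw [mul_inv, ← Real.exp_neg, ← neg_div]
    gcongr ?_⁻¹ * Real.exp (-?_ / _)
    · apply Real.sqrt_le_sqrt
      nlinarith [Real.pi_gt_three]
    · gcongr
  calc |heatKernelDeriv s y| = y / (2 * s) * heatKernel s y := by
        rw [heatKernelDeriv, abs_mul, abs_neg, abs_of_nonneg (heatKernel_nonneg _ _),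
          abs_of_pos (by positivity)]
    _ ≤ 2 * a / (2 * s) * (Real.sqrt s * Real.exp (a ^ 2 / (4 * s)))⁻¹ := by
        gcongr
        exact heatKernel_nonneg _ _
    _ = 32 * (a / (32 * (s * Real.sqrt s * Real.exp (a ^ 2 / (4 * s))))) := by field_simp
    _ ≤ 32 * boundaryMajorant a s := by
        unfold boundaryMajorant
        gcongr 32 * (a / ?_)
        exact add_mul_sqrt_add_le hs

theorem abs_translateDiff_heatKernel_zero_le {s a b : ℝ} (hs : 0 < s) (ha : 0 < a) (hab : a ≤ b)
    (hb : b ≤ 2 * a) :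
    |translateDiff a b heatKernel s 0| ≤ 32 * boundaryMajorant a s * (b - a) := by
  have hmean := (convex_Icc a b).norm_image_sub_le_of_norm_hasDerivWithin_le
    (fun y _ => (hasDerivAt_heatKernel hs.ne' y).hasDerivWithinAt)
    (fun y hy => abs_heatKernelDeriv_le hs ha hy.1 (hy.2.trans hb)) (left_mem_Icc.2 hab)
    (right_mem_Icc.2 hab)
  rw [Real.norm_eq_abs, Real.norm_of_nonneg (sub_nonneg.2 hab)] at hmean
  rwa [translateDiff, zero_sub, zero_sub, heatKernel_neg, heatKernel_neg]

theorem abs_heatKernelDeriv_add_sub_le {s b B y z : ℝ} (hs : 0 < s) (hz : z ∈ Icc 0 b)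
    (hB : ∀ r ∈ Icc (-b) b, |heatKernelDeriv2 s (y + r)| ≤ B) :
    |heatKernelDeriv s (y + z) - heatKernelDeriv s (y - z)| ≤ B * (2 * b) := by
  have hmean := (convex_Icc (-b) b).norm_image_sub_le_of_norm_hasDerivWithin_le
    (f := fun r => heatKernelDeriv s (y + r))
    (fun r _ => ((hasDerivAt_heatKernelDeriv hs.ne' (y + r)).comp_const_add y r).hasDerivWithinAt)
    hB (x := -z) (y := z) ⟨neg_le_neg hz.2, by linarith [hz.1, hz.2]⟩
    ⟨by linarith [hz.1, hz.2], hz.2⟩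
  refine hmean.trans ?_
  rw [Real.norm_of_nonneg (by linarith [hz.1])]
  gcongr
  · exact (abs_nonneg _).trans (hB z ⟨by linarith [hz.1, hz.2], hz.2⟩)
  · linarith [hz.2]

/-- The even part of the kernel is of second order: it vanishes for `a = b`, and its derivative in
`b` vanishes for `b = 0`. -/
theorem exists_abs_translateDiff_add_neg_le {ε : ℝ} (hε : 0 < ε) (S : ℝ) :
    ∃ C : ℝ, ∀ s ∈ Icc ε S, ∀ a b, 0 ≤ a → a ≤ b → b ≤ 1 → ∀ y,
      |translateDiff a b heatKernel s y + translateDiff a b heatKernel s (-y)| ≤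
        C * b * (b - a) * (1 + y ^ 2)⁻¹ := by
  obtain ⟨C, hC⟩ := decaysUniformlyOn_heatKernelDeriv2 hε S
  refine ⟨8 * C, fun s hs a b ha hab hb y => ?_⟩
  have hs0 : 0 < s := hε.trans_le hs.1
  have hC0 : 0 ≤ C := by simpa using (abs_nonneg _).trans (hC s hs 0)
  have hsecond : ∀ r ∈ Icc (-b) b, |heatKernelDeriv2 s (y + r)| ≤ 4 * C * (1 + y ^ 2)⁻¹ := by
    intro r hr
    have hr1 : (-r) ^ 2 ≤ 1 := by nlinarith [hr.1, hr.2]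
    calc |heatKernelDeriv2 s (y + r)| ≤ C * (1 + (y - -r) ^ 2)⁻¹ := by
          rw [sub_neg_eq_add]
          exact hC s hs _
      _ ≤ C * (2 * (1 + 1) * (1 + y ^ 2)⁻¹) := by
          gcongr
          exact (inv_one_add_sub_sq_le y (-r)).trans (by gcongr)
      _ = _ := by ring
  have hmean := (convex_Icc a b).norm_image_sub_le_of_norm_hasDerivWithin_le
    (f := fun z => heatKernel s (y - z) + heatKernel s (y + z))
    (f' := fun z => heatKernelDeriv s (y + z) - heatKernelDeriv s (y - z))
    (fun z _ => (((hasDerivAt_heatKernel hs0.ne' (y - z)).comp_const_sub y z).add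
      ((hasDerivAt_heatKernel hs0.ne' (y + z)).comp_const_add y z)
        |>.congr_deriv (by ring)).hasDerivWithinAt)
    (fun z hz => abs_heatKernelDeriv_add_sub_le hs0 ⟨ha.trans hz.1, hz.2⟩ hsecond)
    (left_mem_Icc.2 hab) (right_mem_Icc.2 hab)
  have heven : translateDiff a b heatKernel s y + translateDiff a b heatKernel s (-y) =
      heatKernel s (y - b) + heatKernel s (y + b) -
        (heatKernel s (y - a) + heatKernel s (y + a)) := by
    simp only [translateDiff, ← neg_add', heatKernel_neg]
    ring
  rw [heven, ← Real.norm_eq_abs]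
  refine hmean.trans (le_of_eq ?_)
  rw [Real.norm_of_nonneg (sub_nonneg.2 hab)]
  ring

/-! ### Absolutely continuous curves in a dual space -/

section

variable {X : Type*} [NormedAddCommGroup X] [NormedSpace ℝ X]

-- Unifying a general normed space with `ℍ⁻¹` is prohibitively slow: the curves live in a dual.
theorem exists_norm_le_of_absolutelyContinuousOnInterval {A : ℝ → StrongDual ℝ X} {a b : ℝ}
    (hA : AbsolutelyContinuousOnInterval A a b) : ∃ C, ∀ t ∈ uIcc a b, ‖A t‖ ≤ C :=
  hA.exists_bound

theorem absolutelyContinuousOnInterval_sub_const {A : ℝ → StrongDual ℝ X} {a b : ℝ}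
    (hA : AbsolutelyContinuousOnInterval A a b) (B : StrongDual ℝ X) :
    AbsolutelyContinuousOnInterval (fun t => A t - B) a b :=
  hA.fun_sub (LipschitzWith.const B).lipschitzOnWith.absolutelyContinuousOnInterval

theorem hasDerivAt_dual_sub_const {A : ℝ → StrongDual ℝ X} {F : StrongDual ℝ X} {t : ℝ}
    (hA : HasDerivAt A F t) (B : StrongDual ℝ X) : HasDerivAt (fun s => A s - B) F t :=
  hA.sub_const B

theorem absolutelyContinuousOnInterval_apply {A : ℝ → StrongDual ℝ X} {φ : ℝ → X} {a b : ℝ}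
    (hA : AbsolutelyContinuousOnInterval A a b) (hφ : AbsolutelyContinuousOnInterval φ a b) :
    AbsolutelyContinuousOnInterval (fun t => A t (φ t)) a b := by
  obtain ⟨C, hC⟩ := hA.exists_bound
  obtain ⟨D, hD⟩ := hφ.exists_bound
  have hlim : Tendsto (fun E : ℕ × (ℕ → ℝ × ℝ) =>
      C * ∑ i ∈ Finset.range E.1, dist (φ (E.2 i).1) (φ (E.2 i).2) +
        D * ∑ i ∈ Finset.range E.1, dist (A (E.2 i).1) (A (E.2 i).2))
      (AbsolutelyContinuousOnInterval.totalLengthFilter ⊓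
        𝓟 (AbsolutelyContinuousOnInterval.disjWithin a b)) (𝓝 0) := by
    unfold AbsolutelyContinuousOnInterval at hA hφ
    simpa using (hφ.const_mul C).add (hA.const_mul D)
  refine squeeze_zero' (Eventually.of_forall fun _ => Finset.sum_nonneg fun i _ => dist_nonneg)
    ?_ hlim
  rw [eventually_inf_principal]
  filter_upwards with E hE
  simp only [Finset.mul_sum, ← Finset.sum_add_distrib]
  refine Finset.sum_le_sum fun i hi => ?_
  have hmem := hE.1 i hi
  generalize (E.2 i).1 = s at hmem ⊢
  generalize (E.2 i).2 = t at hmem ⊢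
  calc dist (A s (φ s)) (A t (φ t)) = ‖A s (φ s - φ t) + (A s - A t) (φ t)‖ := by
        rw [dist_eq_norm, map_sub, sub_apply, sub_add_sub_cancel]
    _ ≤ ‖A s‖ * ‖φ s - φ t‖ + ‖A s - A t‖ * ‖φ t‖ :=
        (norm_add_le _ _).trans (add_le_add ((A s).le_opNorm _) ((A s - A t).le_opNorm _))
    _ ≤ C * dist (φ s) (φ t) + D * dist (A s) (A t) := by
        rw [dist_eq_norm, dist_eq_norm, mul_comm D]
        gcongr
        exacts [hC _ hmem.1, hD _ hmem.2]

theorem hasDerivAt_sub_apply {A : ℝ → StrongDual ℝ X} {F : StrongDual ℝ X} {φ : ℝ → X} {t : ℝ}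
    (hA : HasDerivAt A F t) (hφ : ContinuousAt φ t) :
    HasDerivAt (fun s => (A s - A t) (φ s)) (F (φ t)) t := by
  rw [hasDerivAt_iff_tendsto_slope] at hA ⊢
  have happly : Continuous fun p : StrongDual ℝ X × X => p.1 p.2 :=
    isBoundedBilinearMap_apply.continuous
  refine ((happly.tendsto (F, φ t)).comp
    (hA.prodMk_nhds (hφ.tendsto.mono_left nhdsWithin_le_nhds))).congr fun s => ?_
  simp [slope_def_module]

theorem norm_deriv_le_of_norm_sub_le {f : ℝ → X} {f' : X} {V : ℝ → ℝ} {V' t : ℝ}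
    (hf : HasDerivAt f f' t) (hV : HasDerivAt V V' t)
    (hle : ∀ᶠ s in 𝓝[>] t, ‖f s - f t‖ ≤ V s - V t) : ‖f'‖ ≤ V' := by
  rw [hasDerivAt_iff_tendsto_slope] at hf hV
  have hgt : 𝓝[>] t ≤ 𝓝[≠] t := nhdsWithin_mono _ fun s (hs : t < s) => hs.ne'
  refine le_of_tendsto_of_tendsto (hf.mono_left hgt).norm (hV.mono_left hgt) ?_
  filter_upwards [self_mem_nhdsWithin, hle] with s (hs : t < s) hle
  rw [slope_def_module, slope_def_field, norm_smul, norm_inv, Real.norm_eq_abs,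
    abs_of_pos (sub_pos.2 hs), div_eq_inv_mul]
  exact mul_le_mul_of_nonneg_left hle (inv_nonneg.2 (sub_pos.2 hs).le)

theorem exists_integrableOn_norm_deriv_le {f : ℝ → StrongDual ℝ X} {T : ℝ} (hT : 0 ≤ T)
    (hf : AbsolutelyContinuousOnInterval f 0 T) : ∃ v : ℝ → ℝ, IntegrableOn v (Ioo 0 T) ∧
      ∀ᵐ t ∂(volume.restrict (Ioo 0 T)), ∀ f', HasDerivAt f f' t → ‖f'‖ ≤ v t := by
  have hbv := hf.boundedVariationOn.locallyBoundedVariationOn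
  rw [uIcc_of_le hT] at hbv
  have hzero : (0 : ℝ) ∈ Icc 0 T := left_mem_Icc.2 hT
  set V := variationOnFromTo f (Icc 0 T) 0
  have hmono : MonotoneOn V (Icc 0 T) := variationOnFromTo.monotoneOn hbv hzero
  refine ⟨deriv V, ?_, ?_⟩
  · rw [← intervalIntegrable_iff_integrableOn_Ioo_of_le hT]
    exact MonotoneOn.intervalIntegrable_deriv (by rwa [uIcc_of_le hT])
  rw [ae_restrict_iff' measurableSet_Ioo]
  filter_upwards [hmono.ae_differentiableWithinAt_of_mem] with t hdiff ht f' hf'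
  have htI := Ioo_subset_Icc_self ht
  refine norm_deriv_le_of_norm_sub_le hf'
    ((hdiff htI).differentiableAt (Icc_mem_nhds ht.1 ht.2)).hasDerivAt ?_
  filter_upwards [Ioo_mem_nhdsGT ht.2] with s hs
  have hsI : s ∈ Icc 0 T := ⟨ht.1.le.trans hs.1.le, hs.2.le⟩
  change _ ≤ variationOnFromTo f (Icc 0 T) 0 s - variationOnFromTo f (Icc 0 T) 0 t
  rw [← variationOnFromTo.add hbv hzero htI hsI, add_sub_cancel_left,
    variationOnFromTo.eq_of_le _ _ hs.1.le, ← dist_eq_norm, dist_edist]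
  exact ENNReal.toReal_mono (hbv t s htI hsI) (eVariationOn.edist_le f
    ⟨hsI, hs.1.le, le_rfl⟩ ⟨htI, le_rfl, hs.1.le⟩)

end

/-! ### The corner function -/

/-- The solution `e^{-|y|}` of `E'' = E - 2δ`. Its derivative jumps by `-2` at `0`, so that
subtracting a multiple of it absorbs a boundary source that is constant in time. -/
noncomputable def corner (y : ℝ) : ℝ := Real.exp (-|y|)

/-- The derivative of `corner` away from `0`. -/
noncomputable def cornerDeriv (y : ℝ) : ℝ := -(SignType.sign y : ℝ) * corner y

theorem corner_zero : corner 0 = 1 := by simp [corner]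

theorem continuous_corner : Continuous corner := by
  unfold corner
  fun_prop

theorem corner_le (y : ℝ) : corner y ≤ 2 * (1 + y ^ 2)⁻¹ := by
  have := Real.quadratic_le_exp_of_nonneg (abs_nonneg y)
  rw [sq_abs] at this
  rw [corner, Real.exp_neg, ← div_eq_mul_inv, inv_le_iff_one_le_mul₀ (Real.exp_pos _),
    div_mul_eq_mul_div, le_div_iff₀ (by positivity)]
  linarith [abs_nonneg y]

theorem memLp_corner : MemLp corner 2 :=
  (memLp_inv_one_add_sq.const_mul 2).mono' continuous_corner.aestronglyMeasurable
    (ae_of_all _ fun y => by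
      simpa only [corner, Real.norm_eq_abs, Real.abs_exp] using corner_le y)

theorem abs_cornerDeriv_le (y : ℝ) : |cornerDeriv y| ≤ corner y := by
  have hpos := Real.exp_pos (-|y|)
  rcases lt_trichotomy y 0 with hy | rfl | hy
  · simp [cornerDeriv, corner, sign_neg hy]
  · simp [cornerDeriv, corner]
  · simp [cornerDeriv, corner, sign_pos hy]

theorem measurable_cornerDeriv : Measurable cornerDeriv := by
  have hcases : cornerDeriv = fun y => if 0 < y then -corner y else if y < 0 then corner y else 0 :=
    funext fun y => by
      rcases lt_trichotomy y 0 with hy | rfl | hy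
      · simp [cornerDeriv, sign_neg hy, hy, hy.le]
      · simp [cornerDeriv]
      · simp [cornerDeriv, sign_pos hy, hy]
  rw [hcases]
  exact Measurable.ite measurableSet_Ioi continuous_corner.measurable.neg
    (Measurable.ite measurableSet_Iio continuous_corner.measurable measurable_const)

theorem memLp_cornerDeriv : MemLp cornerDeriv 2 :=
  memLp_corner.mono' measurable_cornerDeriv.aestronglyMeasurable (ae_of_all _ abs_cornerDeriv_le)

theorem isPrimitive_corner : IsPrimitive corner cornerDeriv := by
  refine isPrimitive_of_hasDerivAt_off_countable (countable_singleton 0) continuous_corner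
    (fun y hy => ?_) ?_
  · refine (hasDerivAt_abs hy).neg.exp.congr_deriv ?_
    rw [mul_comm]
    rfl
  · exact memLp_cornerDeriv.locallyIntegrable one_le_two

theorem integral_cornerDeriv_mul_deriv {ψ ψ' : ℝ → ℝ} (hprim : IsPrimitive ψ ψ')
    (hψ : MemLp ψ 2) (hψ' : MemLp ψ' 2) :
    ∫ y, cornerDeriv y * ψ' y = 2 * ψ 0 - ∫ y, corner y * ψ y := by
  have hsum : Integrable fun y => cornerDeriv y * ψ' y + corner y * ψ y :=
    (memLp_cornerDeriv.integrable_mul hψ').add (memLp_corner.integrable_mul hψ)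
  have hmul : Integrable fun y => corner y * ψ y := memLp_corner.integrable_mul hψ
  have hmul' : Integrable fun y => cornerDeriv y * ψ y + corner y * ψ' y :=
    (memLp_cornerDeriv.integrable_mul hψ).add (memLp_corner.integrable_mul hψ')
  have hprod := isPrimitive_corner.mul hprim
  have hright : ∫ y in Ioi 0, (cornerDeriv y * ψ' y + corner y * ψ y) = ψ 0 := by
    have hint := hprod.integral_Ioi_eq (a := 0) hmul.integrableOn hmul'.integrableOn
    rw [corner_zero, one_mul, ← neg_eq_iff_eq_neg, ← integral_neg] at hint
    rw [← hint]
    refine setIntegral_congr_fun measurableSet_Ioi fun y (hy : 0 < y) => ?_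
    simp only [cornerDeriv, sign_pos hy, SignType.coe_one]
    ring
  have hleft : ∫ y in Iic 0, (cornerDeriv y * ψ' y + corner y * ψ y) = ψ 0 := by
    have hint := hprod.integral_Iic_eq (a := 0) hmul.integrableOn hmul'.integrableOn
    rw [corner_zero, one_mul, integral_Iic_eq_integral_Iio] at hint
    rw [← hint, integral_Iic_eq_integral_Iio]
    refine setIntegral_congr_fun measurableSet_Iio fun y (hy : y < 0) => ?_
    simp only [cornerDeriv, sign_neg hy, SignType.coe_neg_one]
    ring
  have hadd := integral_add (memLp_cornerDeriv.integrable_mul hψ') hmul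
  simp only [Pi.mul_apply] at hadd
  rw [eq_sub_iff_add_eq, ← hadd,
    ← intervalIntegral.integral_Iic_add_Ioi hsum.integrableOn hsum.integrableOn (b := 0), hleft,
    hright, two_mul]

/-! ### The equation with a general forcing -/

/-- `F = 𝔻²φ + f - 2 √((ρk)(0)) v δ` in `ℍ⁻¹`, with a forcing `f ∈ L²_ρ(ℝ)` in place of the
term `-qφ` of `EqRHS`. -/
def IsForcedRHS (v : ℝ) (f : L2rho ρ) (φ : H1 ρ k) (F : Hneg1 ρ k) : Prop :=
  ∀ θ : H1 ρ k, F θ = -inner ℝ (opD φ) (opD θ) + inner ℝ f (fn θ) -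
    2 * √(ρ 0 * k 0) * v * valueAtZero (fn θ)

/-- `V` is an even solution of `V_t = 𝔻²V + f - 2 √((ρk)(0)) v δ` on `ℝ × (0,T)`, in the sense of
`IsSolution`. This class, unlike that of `IsSolution`, is stable under subtracting the corner
function. -/
structure IsForcedSolution (T : ℝ) (v : ℝ → ℝ) (f : ℝ → L2rho ρ) (V : ℝ → H1 ρ k) : Prop where
  even : ∀ t ∈ Icc 0 T, IsEven (V t)
  abs_cont : AbsolutelyContinuousOnInterval (fun t => toHneg1 (V t)) 0 T
  equation : ∀ᵐ t ∂(volume.restrict (Ioo 0 T)), ∃ F : Hneg1 ρ k,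
    HasDerivAt (fun s => toHneg1 (V s)) F t ∧ IsForcedRHS (v t) (f t) (V t) F

theorem toHneg1_eq_inner (φ θ : H1 ρ k) : toHneg1 φ θ = inner ℝ (fn φ) (fn θ) := rfl

theorem norm_fn_le (φ : H1 ρ k) : ‖fn φ‖ ≤ ‖φ‖ :=
  (sq_le_sq₀ (norm_nonneg _) (norm_nonneg _)).1
    ((H1.norm_sq φ).symm ▸ le_add_of_nonneg_right (sq_nonneg _))

theorem mul_abs_valueAtZero_le (φ : H1 ρ k) (h : LiouvilleCoefficients ρ k) :
    liouvilleWeight ρ k 0 * |valueAtZero (fn φ)| ≤ ‖φ‖ := by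
  obtain ⟨ψ, ψ', hφ⟩ := H1.exists_isLift φ h
  have hm := h.liouvilleWeight_pos 0
  rw [hφ.valueAtZero_eq h, abs_mul, abs_inv, abs_of_pos hm, mul_left_comm,
    mul_inv_cancel₀ hm.ne', mul_one]
  refine abs_le_of_sq_le_sq ?_ (norm_nonneg φ)
  rw [hφ.norm_sq h]
  exact hφ.isPrimitive.sq_le_integral (hφ.memLp_fst h) (hφ.memLp_snd h) 0

theorem two_mul_sqrt_mul (ρ k : ℝ → ℝ) : 2 * √(ρ 0 * k 0) = 2 * liouvilleWeight ρ k 0 ^ 2 := by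
  rw [liouvilleWeight_sq, mul_comm (k 0)]

theorem IsForcedRHS.norm_le {v : ℝ} {f : L2rho ρ} {φ : H1 ρ k} {F : Hneg1 ρ k} {M : NNReal}
    (hF : IsForcedRHS v f φ F) (hf : ‖f‖ ≤ M * ‖fn φ‖) (h : LiouvilleCoefficients ρ k) :
    ‖φ‖ ≤ (1 + M) * ‖toHneg1 φ‖ + 2 * liouvilleWeight ρ k 0 * |v| + ‖F‖ := by
  set m := liouvilleWeight ρ k 0
  set z := valueAtZero (fn φ)
  have hm : 0 < m := h.liouvilleWeight_pos 0
  rcases (norm_nonneg φ).eq_or_lt with h0 | hpos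
  · rw [← h0]
    positivity
  have hfn : ‖fn φ‖ ^ 2 ≤ ‖toHneg1 φ‖ * ‖φ‖ := by
    rw [← real_inner_self_eq_norm_sq, ← toHneg1_eq_inner]
    exact (le_abs_self _).trans ((toHneg1 φ).le_opNorm φ)
  have hforce : inner ℝ f (fn φ) ≤ M * (‖toHneg1 φ‖ * ‖φ‖) :=
    calc inner ℝ f (fn φ) ≤ M * ‖fn φ‖ * ‖fn φ‖ :=
          (real_inner_le_norm _ _).trans (mul_le_mul_of_nonneg_right hf (norm_nonneg _))
      _ = M * ‖fn φ‖ ^ 2 := by ring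
      _ ≤ _ := mul_le_mul_of_nonneg_left hfn M.2
  have hsource : -(v * (m * z)) ≤ |v| * ‖φ‖ := by
    refine (neg_le_abs _).trans ?_
    rw [abs_mul, abs_mul, abs_of_pos hm]
    exact mul_le_mul_of_nonneg_left (mul_abs_valueAtZero_le φ h) (abs_nonneg v)
  have hdual : -F φ ≤ ‖F‖ * ‖φ‖ := (neg_le_abs _).trans (F.le_opNorm φ)
  refine le_of_mul_le_mul_right ?_ hpos
  have hφ := hF φ
  rw [two_mul_sqrt_mul, real_inner_self_eq_norm_sq] at hφ
  calc ‖φ‖ * ‖φ‖ = ‖fn φ‖ ^ 2 + inner ℝ f (fn φ) + 2 * m * -(v * (m * z)) + -F φ := by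
        rw [← sq, H1.norm_sq, hφ]
        ring
    _ ≤ ‖toHneg1 φ‖ * ‖φ‖ + M * (‖toHneg1 φ‖ * ‖φ‖) + 2 * m * (|v| * ‖φ‖) + ‖F‖ * ‖φ‖ := by
        gcongr
    _ = _ := by ring

theorem IsForcedSolution.exists_integrableOn_norm_le {T : ℝ} {v : ℝ → ℝ} {f : ℝ → L2rho ρ}
    {V : ℝ → H1 ρ k} {M : NNReal} (hV : IsForcedSolution T v f V)
    (hf : ∀ t, ‖f t‖ ≤ M * ‖fn (V t)‖) (h : LiouvilleCoefficients ρ k) (hT : 0 ≤ T)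
    (hv : IntegrableOn v (Ioo 0 T)) :
    ∃ H : ℝ → ℝ, IntegrableOn H (Ioo 0 T) ∧ ∀ᵐ t ∂(volume.restrict (Ioo 0 T)), ‖f t‖ ≤ H t := by
  obtain ⟨C, hC⟩ := exists_norm_le_of_absolutelyContinuousOnInterval hV.abs_cont
  rw [uIcc_of_le hT] at hC
  obtain ⟨w, hw, hderiv⟩ := exists_integrableOn_norm_deriv_le hT hV.abs_cont
  have hconst : IntegrableOn (fun _ : ℝ => (1 + M) * C) (Ioo 0 T) := integrableOn_const (by simp)
  refine ⟨fun t => M * ((1 + M) * C + 2 * liouvilleWeight ρ k 0 * |v t| + w t),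
    ((hconst.add (hv.abs.const_mul (2 * liouvilleWeight ρ k 0))).add hw).const_mul (M : ℝ), ?_⟩
  filter_upwards [hV.equation, hderiv, ae_restrict_mem measurableSet_Ioo]
    with t ⟨F, hF, hrhs⟩ hwt ht
  calc ‖f t‖ ≤ M * ‖V t‖ :=
        (hf t).trans (mul_le_mul_of_nonneg_left (norm_fn_le (V t)) M.2)
    _ ≤ M * ((1 + M) * ‖toHneg1 (V t)‖ + 2 * liouvilleWeight ρ k 0 * |v t| + ‖F‖) :=
        mul_le_mul_of_nonneg_left (hrhs.norm_le (hf t) h) M.2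
    _ ≤ M * ((1 + M) * C + 2 * liouvilleWeight ρ k 0 * |v t| + w t) := by
        gcongr
        · exact hC t (Ioo_subset_Icc_self ht)
        · exact hwt F hF

theorem IsSolution.exists_isForcedSolution {γ u : ℝ → ℝ} {T : ℝ} {W0 : H1 ρ k} {W : ℝ → H1 ρ k}
    (hW : IsSolution γ T u W0 W) (hq : MemLp (pot ρ k γ) ∞) :
    ∃ (M : NNReal) (f : ℝ → L2rho ρ), (∀ t, ‖f t‖ ≤ M * ‖fn (W t)‖) ∧
      IsForcedSolution T u f W := by
  have hac : rhoMeasure ρ ≪ volume := withDensity_absolutelyContinuous _ _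
  have hq' : MemLp (pot ρ k γ) ∞ (rhoMeasure ρ) := by
    have hnorm := hq.2
    rw [eLpNorm_exponent_top] at hnorm
    refine ⟨hq.1.mono_ac hac, ?_⟩
    rw [eLpNorm_exponent_top]
    exact (eLpNormEssSup_mono_measure _ hac).trans_lt hnorm
  set q : Lp ℝ ∞ (rhoMeasure ρ) := hq'.toLp _
  refine ⟨‖q‖₊, fun t => -(q • fn (W t) : L2rho ρ), fun t => ?_, hW.even, hW.abs_cont, ?_⟩
  · rw [norm_neg]
    exact Lp.norm_smul_le (r := 2) q (fn (W t))
  filter_upwards [hW.equation] with t ⟨F, hF, hrhs⟩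
  refine ⟨F, hF, fun θ => ?_⟩
  have hpot : inner ℝ (q • fn (W t) : L2rho ρ) (fn θ) =
      ∫ x, pot ρ k γ x * fn (W t) x * fn θ x ∂(rhoMeasure ρ) := by
    rw [inner_L2rho]
    refine integral_congr_ae ?_
    filter_upwards [Lp.coeFn_lpSMul (r := 2) q (fn (W t)), hq'.coeFn_toLp] with x hx hqx
    rw [hx, ← hqx]
    rfl
  rw [hrhs θ, inner_neg_left, hpot, inner_L2rho]
  rfl

theorem toHneg1_sub (φ θ : H1 ρ k) : toHneg1 (φ - θ) = toHneg1 φ - toHneg1 θ := by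
  ext η
  rw [sub_apply, toHneg1_eq_inner, toHneg1_eq_inner, toHneg1_eq_inner,
    ← inner_sub_left]
  rfl

theorem IsEven.sub {φ θ : H1 ρ k} (hφ : IsEven φ) (hθ : IsEven θ)
    (h : LiouvilleCoefficients ρ k) : IsEven (φ - θ) := by
  have hneg := (Measure.measurePreserving_neg (volume : Measure ℝ)).quasiMeasurePreserving
  have hcoe : fn (φ - θ) =ᵐ[volume] fun x => fn φ x - fn θ x :=
    h.volume_absolutelyContinuous.ae_eq (Lp.coeFn_sub (fn φ) (fn θ))
  filter_upwards [hφ, hθ, hcoe, hneg.ae hcoe] with x hφx hθx hx hnx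
  rw [hnx, hx, hφx, hθx]

theorem IsLift.inner_opD_corner {c : ℝ} {E : H1 ρ k}
    (hE : IsLift E (fun y => -(liouvilleWeight ρ k 0 * c) * corner y)
      fun y => -(liouvilleWeight ρ k 0 * c) * cornerDeriv y)
    (h : LiouvilleCoefficients ρ k) (θ : H1 ρ k) :
    inner ℝ (opD E) (opD θ) =
      -(2 * √(ρ 0 * k 0) * c * valueAtZero (fn θ)) - inner ℝ (fn E) (fn θ) := by
  obtain ⟨ψ, ψ', hθ⟩ := H1.exists_isLift θ h
  have hm := (h.liouvilleWeight_pos 0).ne'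
  rw [hE.snd.inner_eq hθ.snd h, hE.fst.inner_eq hθ.fst h, hθ.valueAtZero_eq h, two_mul_sqrt_mul]
  simp only [mul_assoc, integral_const_mul]
  rw [integral_cornerDeriv_mul_deriv hθ.isPrimitive (hθ.memLp_fst h) (hθ.memLp_snd h)]
  field_simp
  ring

theorem IsForcedRHS.sub_corner {v c : ℝ} {f : L2rho ρ} {φ E : H1 ρ k} {F : Hneg1 ρ k}
    (hF : IsForcedRHS v f φ F)
    (hE : IsLift E (fun y => -(liouvilleWeight ρ k 0 * c) * corner y)
      fun y => -(liouvilleWeight ρ k 0 * c) * cornerDeriv y) (h : LiouvilleCoefficients ρ k) :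
    IsForcedRHS (v - c) (f + fn E) (φ - E) F := by
  intro θ
  have hopD : inner ℝ (opD (φ - E)) (opD θ) =
      inner ℝ (opD φ) (opD θ) - inner ℝ (opD E) (opD θ) := inner_sub_left _ _ _
  rw [hF θ, hopD, inner_add_left, hE.inner_opD_corner h]
  ring

theorem IsForcedSolution.sub_corner {T c : ℝ} {v : ℝ → ℝ} {f : ℝ → L2rho ρ}
    {V : ℝ → H1 ρ k} {E : H1 ρ k} (hV : IsForcedSolution T v f V)
    (hE : IsLift E (fun y => -(liouvilleWeight ρ k 0 * c) * corner y)
      fun y => -(liouvilleWeight ρ k 0 * c) * cornerDeriv y) (h : LiouvilleCoefficients ρ k) :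
    IsForcedSolution T (fun t => v t - c) (fun t => f t + fn E) fun t => V t - E where
  even t ht := (hV.even t ht).sub (hE.isEven h fun y => by simp only [corner, abs_neg]) h
  abs_cont := by
    simpa only [toHneg1_sub] using absolutelyContinuousOnInterval_sub_const hV.abs_cont _
  equation := by
    filter_upwards [hV.equation] with t ⟨F, hF, hrhs⟩
    exact ⟨F, by simpa only [toHneg1_sub] using hasDerivAt_dual_sub_const hF _,
      hrhs.sub_corner hE h⟩

/-! ### Integral estimates in time -/

theorem abs_sub_le_integral_of_abs_deriv_le {f B : ℝ → ℝ} {a b : ℝ} (hab : a ≤ b)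
    (hf : AbsolutelyContinuousOnInterval f a b) (hB : IntervalIntegrable B volume a b)
    (hle : ∀ᵐ t ∂(volume.restrict (Ioo a b)), |deriv f t| ≤ B t) :
    |f b - f a| ≤ ∫ t in a..b, B t := by
  rw [← hf.integral_deriv_eq_sub, ← Real.norm_eq_abs]
  refine intervalIntegral.norm_integral_le_of_norm_le hab ?_ hB
  rwa [← ae_restrict_iff' measurableSet_Ioc, ← Measure.restrict_congr_set Ioo_ae_eq_Ioc]

theorem antitoneOn_boundaryMajorant {a : ℝ} (ha : 0 < a) :
    AntitoneOn (boundaryMajorant a) (Ici 0) := by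
  intro s (hs : 0 ≤ s) r (hr : 0 ≤ r) hsr
  unfold boundaryMajorant
  gcongr

theorem boundaryMajorant_nonneg {a s : ℝ} (ha : 0 < a) (hs : 0 ≤ s) :
    0 ≤ boundaryMajorant a s := by
  unfold boundaryMajorant
  positivity

theorem contDiffOn_boundaryMajorant_sub {a t₁ t₀ : ℝ} (ha : 0 < a) :
    ContDiffOn ℝ 1 (fun t => boundaryMajorant a (t₀ - t)) (Icc t₁ t₀) := by
  have hne : ∀ t ∈ Icc t₁ t₀, a ^ 2 + (t₀ - t) ≠ 0 := fun t ht => by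
    have := sub_nonneg.2 ht.2
    positivity
  have hsum : ContDiffOn ℝ 1 (fun t => a ^ 2 + (t₀ - t)) (Icc t₁ t₀) := by fun_prop
  refine contDiffOn_const.div (hsum.mul (hsum.sqrt hne)) fun t ht => ?_
  have := sub_nonneg.2 ht.2
  positivity

theorem integral_boundaryMajorant_le {a t₁ t₀ : ℝ} (ha : 0 < a) (ht : t₁ ≤ t₀) :
    ∫ t in t₁..t₀, boundaryMajorant a (t₀ - t) ≤ 2 := by
  have hderiv : ∀ t ∈ uIcc t₁ t₀, HasDerivAt (fun t => 2 * a * (√(a ^ 2 + (t₀ - t)))⁻¹)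
      (boundaryMajorant a (t₀ - t)) t := by
    intro t htI
    rw [uIcc_of_le ht] at htI
    have hpos : 0 < a ^ 2 + (t₀ - t) := by
      have := sub_nonneg.2 htI.2
      positivity
    have hsum : HasDerivAt (fun t => a ^ 2 + (t₀ - t)) (-1) t :=
      ((hasDerivAt_id t).const_sub t₀).const_add (a ^ 2)
    have hsqrt := (Real.sqrt_pos.2 hpos).ne'
    refine (((hsum.sqrt hpos.ne').fun_inv hsqrt).const_mul (2 * a)).congr_deriv ?_
    rw [Real.sq_sqrt hpos.le, boundaryMajorant]
    field_simp
  rw [intervalIntegral.integral_eq_sub_of_hasDerivAt hderiv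
    ((contDiffOn_boundaryMajorant_sub ha).continuousOn.intervalIntegrable_of_Icc ht)]
  have hend : 2 * a * (√(a ^ 2 + (t₀ - t₀)))⁻¹ = 2 := by
    rw [sub_self, add_zero, Real.sqrt_sq ha.le, mul_assoc, mul_inv_cancel₀ ha.ne', mul_one]
  rw [hend]
  exact sub_le_self _ (by positivity)

theorem integral_mul_nonpos_of_monotoneOn {w P : ℝ → ℝ} {t₁ t₀ : ℝ} (ht : t₁ ≤ t₀)
    (hw : IntervalIntegrable w volume t₁ t₀) (hP : AbsolutelyContinuousOnInterval P t₁ t₀)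
    (hmono : MonotoneOn P (Icc t₁ t₀)) (hPt₁ : 0 ≤ P t₁)
    (hneg : ∀ t ∈ Icc t₁ t₀, ∫ x in t..t₀, w x ≤ 0) : ∫ t in t₁..t₀, P t * w t ≤ 0 := by
  set B : ℝ → ℝ := fun t => ∫ x in t₀..t, w x
  have hB_nonneg : ∀ t ∈ Icc t₁ t₀, 0 ≤ B t := fun t htI => by
    change 0 ≤ ∫ x in t₀..t, w x
    rw [intervalIntegral.integral_symm]
    exact neg_nonneg.2 (hneg t htI)
  have hB : AbsolutelyContinuousOnInterval B t₁ t₀ :=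
    hw.absolutelyContinuousOnInterval_intervalIntegral right_mem_uIcc
  have hderivB : ∫ t in t₁..t₀, P t * deriv B t = ∫ t in t₁..t₀, P t * w t := by
    refine intervalIntegral.integral_congr_ae ?_
    filter_upwards [hw.ae_hasDerivAt_integral] with t hwt htI
    rw [(hwt (uIoc_subset_uIcc htI) t₀ right_mem_uIcc).deriv]
  have hderivP : 0 ≤ ∫ t in t₁..t₀, deriv P t * B t := by
    refine intervalIntegral.integral_nonneg_of_ae_restrict ht ?_
    rw [← Measure.restrict_congr_set Ioo_ae_eq_Icc]
    filter_upwards [ae_restrict_mem measurableSet_Ioo] with t htI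
    have hderiv := hmono.derivWithin_nonneg (x := t)
    rw [derivWithin_of_mem_nhds (Icc_mem_nhds htI.1 htI.2)] at hderiv
    exact mul_nonneg hderiv (hB_nonneg t (Ioo_subset_Icc_self htI))
  have hparts := hP.integral_mul_deriv_eq_deriv_mul hB
  have hBt₀ : B t₀ = 0 := intervalIntegral.integral_same
  rw [hderivB, hBt₀, mul_zero, zero_sub] at hparts
  linarith [mul_nonneg hPt₁ (hB_nonneg t₁ (left_mem_Icc.2 ht))]

theorem integral_mul_boundaryMajorant_le {v : ℝ → ℝ} {a η t₁ t₀ : ℝ} (ha : 0 < a) (hη : 0 ≤ η)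
    (ht : t₁ ≤ t₀) (hv : IntervalIntegrable v volume t₁ t₀)
    (hle : ∀ t ∈ Icc t₁ t₀, ∫ x in t..t₀, v x ≤ η * (t₀ - t)) :
    ∫ t in t₁..t₀, v t * boundaryMajorant a (t₀ - t) ≤ 2 * η := by
  obtain ⟨L, hL⟩ := (contDiffOn_boundaryMajorant_sub (t₁ := t₁) (t₀ := t₀)
    ha).exists_lipschitzOnWith one_ne_zero (convex_Icc _ _) isCompact_Icc
  rw [← uIcc_of_le ht] at hL
  have hconst : IntervalIntegrable (fun _ : ℝ => η) volume t₁ t₀ := intervalIntegrable_const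
  have hmono : MonotoneOn (fun t => boundaryMajorant a (t₀ - t)) (Icc t₁ t₀) :=
    fun x hx y hy hxy => antitoneOn_boundaryMajorant ha (sub_nonneg.2 hy.2) (sub_nonneg.2 hx.2)
      (sub_le_sub_left hxy t₀)
  have hneg : ∀ t ∈ Icc t₁ t₀, ∫ x in t..t₀, (v x - η) ≤ 0 := by
    intro t htI
    have hvt : IntervalIntegrable v volume t t₀ := by
      refine hv.mono_set ?_
      rw [uIcc_of_le ht, uIcc_of_le htI.2]
      exact Icc_subset_Icc_left htI.1
    rw [intervalIntegral.integral_sub hvt intervalIntegrable_const,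
      intervalIntegral.integral_const, smul_eq_mul]
    linarith [hle t htI]
  have hle_zero := integral_mul_nonpos_of_monotoneOn ht (hv.sub hconst)
    hL.absolutelyContinuousOnInterval hmono (boundaryMajorant_nonneg ha (sub_nonneg.2 ht)) hneg
  simp only [mul_sub] at hle_zero
  rw [intervalIntegral.integral_sub (hv.continuousOn_mul hL.continuousOn)
    (hconst.continuousOn_mul hL.continuousOn), intervalIntegral.integral_mul_const] at hle_zero
  have hmass := mul_le_mul_of_nonneg_right (integral_boundaryMajorant_le ha ht) hη
  simp only [mul_comm (v _)]
  linarith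

theorem ae_exists_integral_abs_sub_le {u : ℝ → ℝ} {T : ℝ} (hu : IntegrableOn u (Ioo 0 T)) :
    ∀ᵐ t₀ ∂(volume.restrict (Ioo 0 T)), ∀ η > 0, ∃ r, 0 < r ∧ r < t₀ ∧
      ∀ s ∈ Icc (t₀ - r) t₀, ∫ x in s..t₀, |u x - u t₀| ≤ η * (t₀ - s) := by
  rw [ae_restrict_iff' measurableSet_Ioo]
  have hloc : LocallyIntegrable ((Ioo 0 T).indicator u) :=
    (hu.integrable_indicator measurableSet_Ioo).locallyIntegrable
  filter_upwards [(IsUnifLocDoublingMeasure.vitaliFamily volume 1).ae_tendsto_average_norm_sub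
    hloc] with t₀ hlim ht₀ η hη
  have hlim_left := (hlim.comp (Real.tendsto_Icc_vitaliFamily_left t₀)).eventually
    (gt_mem_nhds hη)
  obtain ⟨l, hl : l < t₀, hsub⟩ := mem_nhdsLT_iff_exists_Ioo_subset.1 hlim_left
  obtain ⟨c, hc, hct₀⟩ := exists_between (max_lt hl ht₀.1)
  have hc' := max_lt_iff.1 hc
  refine ⟨t₀ - c, sub_pos.2 hct₀, by linarith, fun s hs => ?_⟩
  rw [sub_sub_cancel] at hs
  rcases hs.2.eq_or_lt with rfl | hst
  · simp
  have haverage := hsub ⟨hc'.1.trans_le hs.1, hst⟩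
  simp only [mem_ofPred_eq, Function.comp] at haverage
  rw [setAverage_eq, smul_eq_mul, Real.volume_real_Icc_of_le hst.le,
    inv_mul_lt_iff₀ (sub_pos.2 hst)] at haverage
  rw [intervalIntegral.integral_of_le hst.le, ← integral_Icc_eq_integral_Ioc, mul_comm η]
  refine (setIntegral_congr_fun measurableSet_Icc fun y hy => ?_).trans_le haverage.le
  have hy' : y ∈ Ioo 0 T := ⟨hc'.2.trans_le (hs.1.trans hy.1), hy.2.trans_lt ht₀.2⟩
  simp only [indicator_of_mem hy', indicator_of_mem ht₀, Real.norm_eq_abs]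

theorem ae_intervalIntegrable_mul_rpow {H : ℝ → ℝ} {T p : ℝ} (hH : IntegrableOn H (Ioo 0 T))
    (hp : -1 < p) :
    ∀ᵐ t₀ ∂(volume.restrict (Ioo 0 T)),
      IntervalIntegrable (fun t => H t * (t₀ - t) ^ p) volume 0 t₀ := by
  rw [ae_restrict_iff' measurableSet_Ioo]
  rcases le_or_gt T 0 with hT | hT
  · simp [Ioo_eq_empty_of_le hT]
  have hH' : Integrable ((Ioo 0 T).indicator H) := hH.integrable_indicator measurableSet_Ioo
  have hpow : Integrable ((Ioo 0 T).indicator fun r : ℝ => r ^ p) := by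
    refine IntegrableOn.integrable_indicator ?_ measurableSet_Ioo
    rw [← intervalIntegrable_iff_integrableOn_Ioo_of_le hT.le]
    exact intervalIntegral.intervalIntegrable_rpow' hp
  filter_upwards [hH'.ae_convolution_exists (ContinuousLinearMap.mul ℝ ℝ) hpow] with t₀ hconv ht₀
  rw [intervalIntegrable_iff_integrableOn_Ioo_of_le ht₀.1.le]
  refine (hconv.integrable.integrableOn (s := Ioo 0 t₀)).congr_fun (fun t ht => ?_)
    measurableSet_Ioo
  have htT : t ∈ Ioo 0 T := ⟨ht.1, ht.2.trans ht₀.2⟩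
  have hsubT : t₀ - t ∈ Ioo 0 T := ⟨sub_pos.2 ht.2, by linarith [ht.1, ht₀.2]⟩
  simp [indicator_of_mem htT, indicator_of_mem hsubT]

/-! ### Testing a solution against heat kernels -/

theorem IsForcedRHS.apply_eq {v : ℝ} {f : L2rho ρ} {φ θ : H1 ρ k} {F : Hneg1 ρ k}
    {g g' K K₁ K₂ : ℝ → ℝ} (hF : IsForcedRHS v f φ F) (hφ : IsLift φ g g') (hθ : IsLift θ K K₁)
    (hK₁ : IsPrimitive K₁ K₂) (hK₂ : MemLp K₂ 2) (h : LiouvilleCoefficients ρ k) :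
    F θ = (∫ y, g y * K₂ y) + inner ℝ f (fn θ) - 2 * liouvilleWeight ρ k 0 * v * K 0 := by
  have hg := hφ.memLp_fst h
  have hparts := hφ.isPrimitive.integral_mul_deriv_eq_neg hK₁
    (hg.integrable_mul (hθ.memLp_snd h)) ((hφ.memLp_snd h).integrable_mul (hθ.memLp_snd h))
    (hg.integrable_mul hK₂)
  have := (h.liouvilleWeight_pos 0).ne'
  rw [hF θ, hφ.snd.inner_eq hθ.snd h, ← hparts, hθ.valueAtZero_eq h, two_mul_sqrt_mul]
  field_simp

theorem memLp_translateDiff_heatKernel {s : ℝ} (hs : 0 < s) (a b : ℝ) :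
    MemLp (translateDiff a b heatKernel s) 2 :=
  (decaysUniformlyOn_heatKernel hs s).translateDiff.memLp (left_mem_Icc.2 le_rfl)
    (continuous_translateDiff (continuous_heatKernel hs.ne'))

theorem memLp_translateDiff_heatKernelDeriv {s : ℝ} (hs : 0 < s) (a b : ℝ) :
    MemLp (translateDiff a b heatKernelDeriv s) 2 :=
  (decaysUniformlyOn_heatKernelDeriv hs s).translateDiff.memLp (left_mem_Icc.2 le_rfl)
    (continuous_translateDiff (continuous_heatKernelDeriv hs.ne'))

theorem memLp_translateDiff_heatKernelDeriv2 {s : ℝ} (hs : 0 < s) (a b : ℝ) :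
    MemLp (translateDiff a b heatKernelDeriv2 s) 2 :=
  (decaysUniformlyOn_heatKernelDeriv2 hs s).translateDiff.memLp (left_mem_Icc.2 le_rfl)
    (continuous_translateDiff (continuous_heatKernelDeriv2 hs.ne'))

/-- `Φ : (0,∞) → ℍ¹` is the curve of test functions whose lifts are the differences
`y ↦ G_s(y - b) - G_s(y - a)` of two translates of the heat kernel. -/
def IsHeatKernelLift (a b : ℝ) (Φ : ℝ → H1 ρ k) : Prop :=
  ∀ s > 0, IsLift (Φ s) (translateDiff a b heatKernel s) (translateDiff a b heatKernelDeriv s)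

theorem exists_isHeatKernelLift (h : LiouvilleCoefficients ρ k) (a b : ℝ) :
    ∃ Φ : ℝ → H1 ρ k, IsHeatKernelLift a b Φ := by
  have hex : ∀ s, ∃ φ : H1 ρ k, 0 < s → IsLift φ (translateDiff a b heatKernel s)
      (translateDiff a b heatKernelDeriv s) := by
    intro s
    by_cases hs : 0 < s
    · obtain ⟨φ, hφ⟩ := (isPrimitive_of_hasDerivAt
        (hasDerivAt_translateDiff (hasDerivAt_heatKernel hs.ne'))
        (continuous_translateDiff (continuous_heatKernelDeriv hs.ne'))).exists_isLift
        (memLp_translateDiff_heatKernel hs a b) (memLp_translateDiff_heatKernelDeriv hs a b) h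
      exact ⟨φ, fun _ => hφ⟩
    · exact ⟨0, fun h0 => absurd h0 hs⟩
  choose Φ hΦ using hex
  exact ⟨Φ, hΦ⟩

theorem exists_lipschitzOnWith_of_isLift {Φ : ℝ → H1 ρ k} {K K' : ℝ → ℝ → ℝ} {I : Set ℝ}
    {L L' : ℝ} (hΦ : ∀ s ∈ I, IsLift (Φ s) (K s) (K' s))
    (hK : ∀ s ∈ I, ∀ r ∈ I, ∫ y, (K s y - K r y) ^ 2 ≤ L * |s - r| ^ 2)
    (hK' : ∀ s ∈ I, ∀ r ∈ I, ∫ y, (K' s y - K' r y) ^ 2 ≤ L' * |s - r| ^ 2)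
    (h : LiouvilleCoefficients ρ k) : ∃ M : NNReal, LipschitzOnWith M Φ I := by
  refine ⟨(√(L + L')).toNNReal, LipschitzOnWith.of_dist_le_mul fun s hs r hr => ?_⟩
  rw [Real.coe_toNNReal _ (Real.sqrt_nonneg _), dist_eq_norm, Real.dist_eq,
    ← Real.sqrt_sq (abs_nonneg (s - r)), ← Real.sqrt_mul' _ (sq_nonneg _)]
  refine Real.le_sqrt_of_sq_le ?_
  rw [((hΦ s hs).sub (hΦ r hr) h).norm_sq h, add_mul]
  exact add_le_add (hK s hs r hr) (hK' s hs r hr)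

theorem IsHeatKernelLift.exists_lipschitzOnWith {Φ : ℝ → H1 ρ k} {a b ε : ℝ}
    (hΦ : IsHeatKernelLift a b Φ) (hε : 0 < ε) (S : ℝ) (h : LiouvilleCoefficients ρ k) :
    ∃ M : NNReal, LipschitzOnWith M Φ (Icc ε S) := by
  have hpos : ∀ s ∈ Icc ε S, 0 < s := fun s hs => hε.trans_le hs.1
  have hdecay := (decaysUniformlyOn_heatKernelDeriv2 hε S).translateDiff (a := a) (b := b)
  obtain ⟨L, hL⟩ := hdecay.exists_integral_sub_sq_le (convex_Icc ε S) fun s hs =>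
    hasDerivAt_translateDiff_time (hasDerivAt_heatKernel_time (hpos s hs))
  have hdecay' := (decaysUniformlyOn_heatKernelDeriv3 hε S).translateDiff (a := a) (b := b)
  obtain ⟨L', hL'⟩ := hdecay'.exists_integral_sub_sq_le (convex_Icc ε S) fun s hs =>
    hasDerivAt_translateDiff_time (hasDerivAt_heatKernelDeriv_time (hpos s hs))
  exact exists_lipschitzOnWith_of_isLift (fun s hs => hΦ s (hpos s hs)) hL hL' h

theorem toHneg1_apply_eq_integral {φ θ : H1 ρ k} {g g' ψ ψ' : ℝ → ℝ} (hφ : IsLift φ g g')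
    (hθ : IsLift θ ψ ψ') (h : LiouvilleCoefficients ρ k) :
    toHneg1 φ θ = ∫ y, g y * ψ y :=
  hφ.fst.inner_eq hθ.fst h

section

variable {V : ℝ → H1 ρ k} {Φ : ℝ → H1 ρ k} {a b : ℝ}

-- The term `𝔻²` of the equation cancels the time derivative of the backward heat kernel.
theorem hasDerivAt_toHneg1_apply {v t τ : ℝ} {f : L2rho ρ} {F : Hneg1 ρ k}
    (hΦ : IsHeatKernelLift a b Φ)
    (hV : HasDerivAt (fun s => toHneg1 (V s)) F t) (hF : IsForcedRHS v f (V t) F) (ht : t < τ)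
    (h : LiouvilleCoefficients ρ k) :
    HasDerivAt (fun s => toHneg1 (V s) (Φ (τ - s)))
      (inner ℝ f (fn (Φ (τ - t))) -
        2 * liouvilleWeight ρ k 0 * v * translateDiff a b heatKernel (τ - t) 0) t := by
  have hs : 0 < τ - t := sub_pos.2 ht
  obtain ⟨g, g', hg⟩ := H1.exists_isLift (V t) h
  have hnhds : Icc ((τ - t) / 2) (2 * (τ - t)) ∈ 𝓝 (τ - t) :=
    Icc_mem_nhds (by linarith) (by linarith)
  obtain ⟨M, hM⟩ := hΦ.exists_lipschitzOnWith (half_pos hs) (2 * (τ - t)) h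
  have hpos : ∀ r ∈ Icc ((τ - t) / 2) (2 * (τ - t)), 0 < r := fun r hr =>
    (half_pos hs).trans_le hr.1
  have hcont : ContinuousAt (fun s => Φ (τ - s)) t :=
    (hM.continuousOn.continuousAt hnhds).comp (by fun_prop)
  have hspace : HasDerivAt (fun s => ∫ y, g y * translateDiff a b heatKernel (τ - s) y)
      (-∫ y, g y * translateDiff a b heatKernelDeriv2 (τ - t) y) t :=
    ((decaysUniformlyOn_heatKernelDeriv2 (half_pos hs) _).translateDiff.hasDerivAt_integral_mul
      hnhds (fun r hr => hasDerivAt_translateDiff_time (hasDerivAt_heatKernel_time (hpos r hr)))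
      (fun r hr => memLp_translateDiff_heatKernel (hpos r hr) a b)
      (continuous_translateDiff (continuous_heatKernelDeriv2 hs.ne'))
      (hg.memLp_fst h)).comp_const_sub τ t
  have hsum := (hasDerivAt_sub_apply hV hcont).add hspace
  rw [hF.apply_eq hg (hΦ _ hs) (isPrimitive_of_hasDerivAt
    (hasDerivAt_translateDiff (hasDerivAt_heatKernelDeriv hs.ne'))
    (continuous_translateDiff (continuous_heatKernelDeriv2 hs.ne')))
    (memLp_translateDiff_heatKernelDeriv2 hs a b) h] at hsum
  refine (hsum.congr_deriv (by ring)).congr_of_eventuallyEq ?_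
  filter_upwards [Iio_mem_nhds ht] with s hsτ
  rw [Pi.add_apply, ← toHneg1_apply_eq_integral hg (hΦ _ (sub_pos.2 hsτ)) h, sub_apply,
    sub_add_cancel]

theorem IsHeatKernelLift.norm_fn_le {s : ℝ} (hΦ : IsHeatKernelLift a b Φ) (hs : 0 < s)
    (hab : a ≤ b) (h : LiouvilleCoefficients ρ k) :
    ‖fn (Φ s)‖ ≤ (b - a) * s ^ (-(3 / 4) : ℝ) := by
  refine (sq_le_sq₀ (norm_nonneg _)
    (mul_nonneg (sub_nonneg.2 hab) (Real.rpow_nonneg hs.le _))).1 ?_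
  rw [(hΦ s hs).fst.norm_sq h]
  exact integral_translateDiff_heatKernel_sq_le hs a b

theorem IsHeatKernelLift.abs_inner_sub_le {s c : ℝ} (hΦ : IsHeatKernelLift a b Φ) {r : ℝ}
    (hr : 0 < r) (hrs : r ≤ s) (ha : 0 < a) (hab : a ≤ b) (hb : b ≤ 2 * a) (hc : 0 ≤ c) (v : ℝ)
    (f : L2rho ρ) (h : LiouvilleCoefficients ρ k) :
    |inner ℝ f (fn (Φ s)) - 2 * c * v * translateDiff a b heatKernel s 0| ≤
      (b - a) * (‖f‖ * r ^ (-(3 / 4) : ℝ) + 64 * c * (|v| * boundaryMajorant a r)) := by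
  have hs : 0 < s := hr.trans_le hrs
  have hab' := sub_nonneg.2 hab
  have hforce : |inner ℝ f (fn (Φ s))| ≤ ‖f‖ * ((b - a) * r ^ (-(3 / 4) : ℝ)) := by
    refine (abs_real_inner_le_norm _ _).trans (mul_le_mul_of_nonneg_left ?_ (norm_nonneg f))
    exact (hΦ.norm_fn_le hs hab h).trans (mul_le_mul_of_nonneg_left
      (Real.rpow_le_rpow_of_nonpos hr hrs (by norm_num)) hab')
  have hsource : |2 * c * v * translateDiff a b heatKernel s 0| ≤
      2 * c * |v| * (32 * boundaryMajorant a r * (b - a)) := by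
    rw [abs_mul, abs_mul, abs_of_nonneg (mul_nonneg zero_le_two hc)]
    refine mul_le_mul_of_nonneg_left ?_ (by positivity)
    refine (abs_translateDiff_heatKernel_zero_le hs ha hab hb).trans ?_
    have := antitoneOn_boundaryMajorant ha hr.le hs.le hrs
    gcongr
  refine (abs_sub _ _).trans ((add_le_add hforce hsource).trans_eq ?_)
  ring

end

theorem tendsto_integral_mul_translateDiff_heatKernel {g g' : ℝ → ℝ} (hprim : IsPrimitive g g')
    (hg : MemLp g 2) (hg' : MemLp g' 2) (a b : ℝ) :
    Tendsto (fun s => ∫ y, g y * translateDiff a b heatKernel s y) (𝓝[>] 0) (𝓝 (g b - g a)) := by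
  have hbound : ∀ y, |g y| ≤ √((∫ y, g y ^ 2) + ∫ y, g' y ^ 2) := fun y =>
    Real.abs_le_sqrt (hprim.sq_le_integral hg hg' y)
  refine ((tendsto_integral_mul_heatKernel hprim.continuous hbound b).sub
    (tendsto_integral_mul_heatKernel hprim.continuous hbound a)).congr' ?_
  filter_upwards [self_mem_nhdsWithin] with s (hs : 0 < s)
  simp only [translateDiff, mul_sub]
  exact (integral_sub (hg.integrable_mul (memLp_heatKernel_comp_sub hs b))
    (hg.integrable_mul (memLp_heatKernel_comp_sub hs a))).symm

-- Against an even function only the even part of the kernel counts, which is of second order.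
theorem exists_abs_integral_mul_translateDiff_le {g : ℝ → ℝ} (hg : MemLp g 2)
    (heven : ∀ y, g (-y) = g y) {ε : ℝ} (hε : 0 < ε) (S : ℝ) :
    ∃ C : ℝ, ∀ s ∈ Icc ε S, ∀ a b, 0 ≤ a → a ≤ b → b ≤ 1 →
      |∫ y, g y * translateDiff a b heatKernel s y| ≤ C * b * (b - a) := by
  obtain ⟨C, hC⟩ := exists_abs_translateDiff_add_neg_le hε S
  refine ⟨(∫ y, |g y| * (1 + y ^ 2)⁻¹) * C / 2, fun s hs a b ha hab hb => ?_⟩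
  have hint : Integrable fun y => g y * translateDiff a b heatKernel s y :=
    hg.integrable_mul (memLp_translateDiff_heatKernel (hε.trans_le hs.1) a b)
  have hsymm : 2 * ∫ y, g y * translateDiff a b heatKernel s y =
      ∫ y, g y * (translateDiff a b heatKernel s y + translateDiff a b heatKernel s (-y)) := by
    have hneg := integral_neg_eq_self (fun y => g y * translateDiff a b heatKernel s y) volume
    have hadd := integral_add hint hint.comp_neg
    rw [hneg, ← two_mul] at hadd
    simp only [← hadd, heven, mul_add]
  have hle : |2 * ∫ y, g y * translateDiff a b heatKernel s y| ≤
      ∫ y, |g y| * (1 + y ^ 2)⁻¹ * (C * b * (b - a)) := by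
    rw [hsymm, ← Real.norm_eq_abs]
    refine norm_integral_le_of_norm_le
      ((hg.abs.integrable_mul memLp_inv_one_add_sq).mul_const _) (ae_of_all _ fun y => ?_)
    rw [Real.norm_eq_abs, abs_mul]
    refine (mul_le_mul_of_nonneg_left (hC s hs a b ha hab hb y) (abs_nonneg (g y))).trans_eq ?_
    ring
  rw [integral_mul_const, abs_mul, abs_two] at hle
  linarith

namespace IsForcedSolution

variable {V Φ : ℝ → H1 ρ k} {v : ℝ → ℝ} {f : ℝ → L2rho ρ} {T t₁ t₀ τ a b : ℝ}

theorem absolutelyContinuousOnInterval_toHneg1_apply (hV : IsForcedSolution T v f V)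
    (hΦ : IsHeatKernelLift a b Φ) (ht₁ : 0 ≤ t₁) (ht : t₁ ≤ t₀) (ht₀ : t₀ ≤ T) (hτ : t₀ < τ)
    (h : LiouvilleCoefficients ρ k) :
    AbsolutelyContinuousOnInterval (fun s => toHneg1 (V s) (Φ (τ - s))) t₁ t₀ := by
  obtain ⟨M, hM⟩ := hΦ.exists_lipschitzOnWith (sub_pos.2 hτ) (τ - t₁) h
  have hmaps : MapsTo (fun s => τ - s) (uIcc t₁ t₀) (Icc (τ - t₀) (τ - t₁)) := by
    rw [uIcc_of_le ht]
    exact fun s hs => ⟨sub_le_sub_left hs.2 τ, sub_le_sub_left hs.1 τ⟩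
  have hlip := hM.comp (IsometryEquiv.subLeft τ).isometry.lipschitz.lipschitzOnWith hmaps
  refine absolutelyContinuousOnInterval_apply (hV.abs_cont.mono ?_)
    hlip.absolutelyContinuousOnInterval
  rw [uIcc_of_le ht, uIcc_of_le (ht₁.trans (ht.trans ht₀))]
  exact Icc_subset_Icc ht₁ ht₀

theorem abs_toHneg1_apply_sub_le {H : ℝ → ℝ} (hV : IsForcedSolution T v f V)
    (hΦ : IsHeatKernelLift a b Φ) (ha : 0 < a) (hab : a ≤ b) (hb : b ≤ 2 * a)
    (ht₁ : 0 ≤ t₁) (ht : t₁ ≤ t₀) (ht₀ : t₀ ≤ T) (hτ : t₀ < τ)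
    (hf : ∀ᵐ t ∂(volume.restrict (Ioo 0 T)), ‖f t‖ ≤ H t)
    (hH : IntervalIntegrable (fun t => H t * (t₀ - t) ^ (-(3 / 4) : ℝ)) volume t₁ t₀)
    (hv : IntervalIntegrable v volume t₁ t₀) (h : LiouvilleCoefficients ρ k) :
    |toHneg1 (V t₀) (Φ (τ - t₀)) - toHneg1 (V t₁) (Φ (τ - t₁))| ≤
      (b - a) * ((∫ t in t₁..t₀, H t * (t₀ - t) ^ (-(3 / 4) : ℝ)) +
        64 * liouvilleWeight ρ k 0 * ∫ t in t₁..t₀, |v t| * boundaryMajorant a (t₀ - t)) := by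
  have hsource : IntervalIntegrable (fun t => |v t| * boundaryMajorant a (t₀ - t))
      volume t₁ t₀ := by
    refine hv.abs.mul_continuousOn ?_
    rw [uIcc_of_le ht]
    exact (contDiffOn_boundaryMajorant_sub ha).continuousOn
  have hsource' := hsource.const_mul (64 * liouvilleWeight ρ k 0)
  rw [← intervalIntegral.integral_const_mul, ← intervalIntegral.integral_add hH hsource',
    ← intervalIntegral.integral_const_mul]
  refine abs_sub_le_integral_of_abs_deriv_le ht
    (hV.absolutelyContinuousOnInterval_toHneg1_apply hΦ ht₁ ht ht₀ hτ h)
    ((hH.add hsource').const_mul (b - a)) ?_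
  have hsub := ae_mono (Measure.restrict_mono_set volume (Ioo_subset_Ioo ht₁ ht₀))
  filter_upwards [hsub hV.equation, hsub hf, ae_restrict_mem measurableSet_Ioo]
    with t ⟨F, hF, hrhs⟩ hft htI
  rw [(hasDerivAt_toHneg1_apply hΦ hF hrhs (htI.2.trans hτ) h).deriv]
  refine (hΦ.abs_inner_sub_le (sub_pos.2 htI.2) (sub_le_sub_right hτ.le t) ha hab hb
    (h.liouvilleWeight_pos 0).le (v t) (f t) h).trans ?_
  have := sub_nonneg.2 hab
  have := Real.rpow_nonneg (sub_nonneg.2 htI.2.le) (-(3 / 4) : ℝ)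
  gcongr

theorem exists_abs_sub_le {H g g' : ℝ → ℝ} (hV : IsForcedSolution T v f V)
    (hg : IsLift (V t₀) g g') (ht₁ : 0 ≤ t₁) (ht : t₁ < t₀) (ht₀ : t₀ ≤ T)
    (hf : ∀ᵐ t ∂(volume.restrict (Ioo 0 T)), ‖f t‖ ≤ H t)
    (hH : IntervalIntegrable (fun t => H t * (t₀ - t) ^ (-(3 / 4) : ℝ)) volume t₁ t₀)
    (hv : IntervalIntegrable v volume t₁ t₀) (h : LiouvilleCoefficients ρ k) :
    ∃ C : ℝ, ∀ a b, 0 < a → a ≤ b → b ≤ 2 * a → b ≤ 1 → |g b - g a| ≤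
      (b - a) * (C * b + ((∫ t in t₁..t₀, H t * (t₀ - t) ^ (-(3 / 4) : ℝ)) +
        64 * liouvilleWeight ρ k 0 * ∫ t in t₁..t₀, |v t| * boundaryMajorant a (t₀ - t))) := by
  obtain ⟨g₁, g₁', hg₁⟩ := H1.exists_isLift (V t₁) h
  obtain ⟨C, hC⟩ := exists_abs_integral_mul_translateDiff_le (hg₁.memLp_fst h)
    (hg₁.even h (hV.even t₁ ⟨ht₁, ht.le.trans ht₀⟩)) (sub_pos.2 ht) (t₀ - t₁ + 1)
  refine ⟨C, fun a b ha hab hb2a hb => ?_⟩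
  obtain ⟨Φ, hΦ⟩ := exists_isHeatKernelLift h a b
  refine le_of_tendsto (tendsto_integral_mul_translateDiff_heatKernel hg.isPrimitive
    (hg.memLp_fst h) (hg.memLp_snd h) a b).abs ?_
  filter_upwards [Ioo_mem_nhdsGT one_pos] with ε hε
  have hstart := hC (t₀ + ε - t₁) ⟨by linarith [hε.1], by linarith [hε.2]⟩ a b ha.le hab hb
  have hincrement := hV.abs_toHneg1_apply_sub_le hΦ ha hab hb2a ht₁ ht.le ht₀
    (lt_add_of_pos_right t₀ hε.1) hf hH hv h
  rw [add_sub_cancel_left, toHneg1_apply_eq_integral hg (hΦ ε hε.1) h,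
    toHneg1_apply_eq_integral hg₁ (hΦ _ (by linarith [hε.1])) h] at hincrement
  rw [mul_add]
  have := abs_sub_abs_le_abs_sub (∫ y, g y * translateDiff a b heatKernel ε y)
    (∫ y, g₁ y * translateDiff a b heatKernel (t₀ + ε - t₁) y)
  linarith

end IsForcedSolution

/-! ### The boundary value of the derivative -/

theorem hasValueAtZeroPlus_zero_of_abs_sub_le {g g' : ℝ → ℝ} (hg : IsPrimitive g g')
    (hle : ∀ η > 0, ∀ᶠ b in 𝓝[>] 0, ∀ a ∈ Icc (b / 2) b, |g b - g a| ≤ η * (b - a)) :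
    HasValueAtZeroPlus g' 0 := by
  refine Metric.tendsto_nhds.2 fun η hη => ?_
  have hpos : ∀ᶠ x : ℝ in 𝓝[>] 0, 0 < x := self_mem_nhdsWithin
  filter_upwards [mem_inf_of_left hpos, mem_inf_of_right hg.ae_hasDerivAt,
    mem_inf_of_left (eventually_eventually_nhdsWithin.2 (hle (η / 2) (half_pos hη)))]
    with x hx hderiv hslope
  rw [nhdsWithin_eq_nhds.2 (Ioi_mem_nhds hx)] at hslope
  have hlinear : HasDerivAt (fun s => η / 2 * s) (η / 2) x := by
    simpa using (hasDerivAt_id x).const_mul (η / 2)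
  rw [dist_zero_right]
  refine (norm_deriv_le_of_norm_sub_le hderiv hlinear ?_).trans_lt (half_lt_self hη)
  filter_upwards [nhdsWithin_le_nhds hslope, Ioo_mem_nhdsGT (show x < 2 * x by linarith)]
    with s hs hsx
  rw [← mul_sub]
  exact hs x ⟨by linarith [hsx.2], hsx.1.le⟩

theorem tendsto_intervalIntegral_zero_left {F : ℝ → ℝ} {t₁ t₀ : ℝ} (ht : t₁ < t₀)
    (hF : IntervalIntegrable F volume t₁ t₀) :
    Tendsto (fun t => ∫ x in t..t₀, F x) (𝓝[<] t₀) (𝓝 0) := by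
  have hcont := intervalIntegral.continuousOn_primitive_interval_left
    ((intervalIntegrable_iff' (by finiteness)).1 hF) t₀ right_mem_uIcc
  rw [ContinuousWithinAt, intervalIntegral.integral_same, uIcc_of_le ht.le] at hcont
  exact hcont.mono_left (nhdsWithin_le_of_mem
    (mem_of_superset (Ioo_mem_nhdsLT ht) Ioo_subset_Icc_self))

theorem IsForcedSolution.hasValueAtZeroPlus_zero {T t₀ : ℝ} {v H g g' : ℝ → ℝ} {f : ℝ → L2rho ρ}
    {V : ℝ → H1 ρ k} (hV : IsForcedSolution T v f V) (hg : IsLift (V t₀) g g')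
    (ht₀ : t₀ ∈ Ioo 0 T) (hf : ∀ᵐ t ∂(volume.restrict (Ioo 0 T)), ‖f t‖ ≤ H t)
    (hH : IntervalIntegrable (fun t => H t * (t₀ - t) ^ (-(3 / 4) : ℝ)) volume 0 t₀)
    (hv : IntervalIntegrable v volume 0 t₀)
    (hmean : ∀ η > 0, ∃ r, 0 < r ∧ r < t₀ ∧
      ∀ s ∈ Icc (t₀ - r) t₀, ∫ x in s..t₀, |v x| ≤ η * (t₀ - s))
    (h : LiouvilleCoefficients ρ k) : HasValueAtZeroPlus g' 0 := by
  refine hasValueAtZeroPlus_zero_of_abs_sub_le hg.isPrimitive fun η hη => ?_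
  have hm := h.liouvilleWeight_pos 0
  obtain ⟨r, hr, hrt₀, hmean⟩ := hmean (η / (384 * liouvilleWeight ρ k 0)) (by positivity)
  obtain ⟨t₁, htail, ht₁⟩ := (((tendsto_intervalIntegral_zero_left ht₀.1 hH).eventually
    (gt_mem_nhds (show 0 < η / 3 by positivity))).and
      (Ioo_mem_nhdsLT (sub_lt_self t₀ hr))).exists
  have ht₁_pos : 0 < t₁ := (sub_pos.2 hrt₀).trans ht₁.1
  have hsub : uIcc t₁ t₀ ⊆ uIcc 0 t₀ := by
    rw [uIcc_of_le ht₁.2.le, uIcc_of_le ht₀.1.le]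
    exact Icc_subset_Icc_left ht₁_pos.le
  obtain ⟨C, hC⟩ := hV.exists_abs_sub_le hg ht₁_pos.le ht₁.2 ht₀.2.le hf (hH.mono_set hsub)
    (hv.mono_set hsub) h
  have hlinear : Tendsto (fun b => C * b) (𝓝[>] 0) (𝓝 0) := by
    simpa using ((continuous_const_mul C).tendsto 0).mono_left nhdsWithin_le_nhds
  filter_upwards [hlinear.eventually (gt_mem_nhds (show 0 < η / 3 by positivity)),
    Ioo_mem_nhdsGT one_pos] with b hCb hb a ha
  have ha_pos : 0 < a := (half_pos hb.1).trans_le ha.1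
  have hsource := integral_mul_boundaryMajorant_le ha_pos (by positivity) ht₁.2.le
    (hv.mono_set hsub).abs fun s hs => hmean s (Icc_subset_Icc_left ht₁.1.le hs)
  have hsource' : 64 * liouvilleWeight ρ k 0 *
      (∫ t in t₁..t₀, |v t| * boundaryMajorant a (t₀ - t)) ≤ η / 3 := by
    refine (mul_le_mul_of_nonneg_left hsource (by positivity)).trans_eq ?_
    field_simp
    norm_num
  refine (hC a b ha_pos ha.2 (by linarith [ha.1]) hb.2.le).trans ?_
  rw [mul_comm η]
  exact mul_le_mul_of_nonneg_left (by linarith) (sub_nonneg.2 ha.2)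

theorem hasValueAtZeroPlus_cornerDeriv : HasValueAtZeroPlus cornerDeriv (-1) := by
  have hcont : Tendsto (fun y => -corner y) (𝓝[>] 0 ⊓ ae volume) (𝓝 (-1)) := by
    rw [← corner_zero]
    exact (continuous_corner.neg.tendsto 0).mono_left (inf_le_left.trans nhdsWithin_le_nhds)
  refine hcont.congr' (mem_inf_of_left ?_)
  filter_upwards [self_mem_nhdsWithin] with y (hy : 0 < y)
  rw [cornerDeriv, sign_pos hy, SignType.coe_one, neg_one_mul]

theorem exists_isLift_corner (h : LiouvilleCoefficients ρ k) (c : ℝ) : ∃ E : H1 ρ k,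
    IsLift E (fun y => c * corner y) fun y => c * cornerDeriv y :=
  (isPrimitive_corner.const_mul c).exists_isLift (memLp_corner.const_mul c)
    (memLp_cornerDeriv.const_mul c) h

theorem IsForcedSolution.hasValueAtZeroPlus_opD {T t₀ : ℝ} {v H : ℝ → ℝ} {f : ℝ → L2rho ρ}
    {V : ℝ → H1 ρ k} (hV : IsForcedSolution T v f V)
    (ht₀ : t₀ ∈ Ioo 0 T) (hf : ∀ᵐ t ∂(volume.restrict (Ioo 0 T)), ‖f t‖ ≤ H t)
    (hH : IntervalIntegrable (fun t => H t * (t₀ - t) ^ (-(3 / 4) : ℝ)) volume 0 t₀)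
    (hv : IntervalIntegrable v volume 0 t₀)
    (hmean : ∀ η > 0, ∃ r, 0 < r ∧ r < t₀ ∧
      ∀ s ∈ Icc (t₀ - r) t₀, ∫ x in s..t₀, |v x - v t₀| ≤ η * (t₀ - s))
    (h : LiouvilleCoefficients ρ k) : HasValueAtZeroPlus (opD (V t₀)) (v t₀) := by
  have hm := (h.liouvilleWeight_pos 0).ne'
  obtain ⟨E, hE⟩ := exists_isLift_corner h (-(liouvilleWeight ρ k 0 * v t₀))
  obtain ⟨g, g', hg⟩ := H1.exists_isLift (V t₀) h
  have hfE : ∀ᵐ t ∂(volume.restrict (Ioo 0 T)), ‖f t + fn E‖ ≤ H t + ‖fn E‖ := by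
    filter_upwards [hf] with t ht
    exact (norm_add_le _ _).trans (add_le_add_left ht _)
  have hpow : IntervalIntegrable (fun t => (t₀ - t) ^ (-(3 / 4) : ℝ)) volume 0 t₀ := by
    have := (intervalIntegral.intervalIntegrable_rpow' (a := t₀) (b := 0)
      (show (-1 : ℝ) < -(3 / 4) by norm_num)).comp_sub_left t₀
    rwa [sub_self, sub_zero] at this
  have hHE : IntervalIntegrable (fun t => (H t + ‖fn E‖) * (t₀ - t) ^ (-(3 / 4) : ℝ))
      volume 0 t₀ := by
    simp only [add_mul]
    exact hH.add (hpow.const_mul _)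
  have hzero := (hV.sub_corner hE h).hasValueAtZeroPlus_zero (hg.sub hE h) ht₀ hfE hHE
    (hv.sub intervalIntegrable_const) hmean h
  have hcorner := Tendsto.add hzero
    (hasValueAtZeroPlus_cornerDeriv.const_mul (-(liouvilleWeight ρ k 0 * v t₀)))
  simp only [sub_add_cancel] at hcorner
  convert hg.snd.hasValueAtZeroPlus h hcorner using 1
  field_simp
  ring

theorem IsSolution.ae_hasValueAtZeroPlus_opD {γ u : ℝ → ℝ} {T : ℝ} {W0 : H1 ρ k} {W : ℝ → H1 ρ k}
    (hW : IsSolution γ T u W0 W) (h : LiouvilleCoefficients ρ k) (hq : MemLp (pot ρ k γ) ∞)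
    (hT : 0 ≤ T) (hu : IntegrableOn u (Ioo 0 T)) :
    ∀ᵐ t ∂(volume.restrict (Ioo 0 T)), HasValueAtZeroPlus (opD (W t)) (u t) := by
  obtain ⟨M, f, hfM, hWf⟩ := hW.exists_isForcedSolution hq
  obtain ⟨H, hH, hfH⟩ := hWf.exists_integrableOn_norm_le hfM h hT hu
  filter_upwards [ae_intervalIntegrable_mul_rpow hH (show -1 < -(3 / 4) by norm_num),
    ae_exists_integral_abs_sub_le hu, ae_restrict_mem measurableSet_Ioo] with t₀ hHt₀ hmean ht₀
  refine hWf.hasValueAtZeroPlus_opD ht₀ hfH hHt₀ ?_ hmean h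
  exact (intervalIntegrable_iff_integrableOn_Ioo_of_le ht₀.1.le).2
    (hu.mono_set (Ioo_subset_Ioo_right ht₀.2.le))

/-! ### The Neumann condition -/

theorem IsWeakDerivOn.mono {Ω Ω' : Set ℝ} {f f' : ℝ → ℝ} (hf : IsWeakDerivOn Ω f f')
    (hΩ : Ω' ⊆ Ω) : IsWeakDerivOn Ω' f f' :=
  ⟨hf.loc.mono_set hΩ, hf.loc_deriv.mono_set hΩ,
    fun ψ hψ hsupp hsub => hf.by_parts ψ hψ hsupp (hsub.trans hΩ)⟩

theorem IsWeakDerivOn.congr_left {Ω : Set ℝ} {f g f' : ℝ → ℝ} (hf : IsWeakDerivOn Ω f f')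
    (hfg : f =ᵐ[volume] g) : IsWeakDerivOn Ω g f' := by
  refine ⟨hf.loc.congr (ae_restrict_of_ae hfg), hf.loc_deriv, fun ψ hψ hsupp hsub => ?_⟩
  rw [← hf.by_parts ψ hψ hsupp hsub]
  refine integral_congr_ae ?_
  filter_upwards [hfg] with x hx
  rw [hx]

theorem H1.exists_isWeakDerivOn_hasValueAtZeroPlus {φ : H1 ρ k} {c : ℝ}
    (hφ : HasValueAtZeroPlus (opD φ) c) (h : LiouvilleCoefficients ρ k) :
    ∃ wx : ℝ → ℝ, IsWeakDerivOn (Ioi 0) (fn φ) wx ∧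
      HasValueAtZeroPlus (fun x => √(k x / ρ x) * wx x) c := by
  obtain ⟨f, f', hf, hprim, hopD⟩ := H1.exists_isPrimitive φ h
  refine ⟨f', (hprim.isWeakDerivOn.mono (subset_univ _)).congr_left hf.symm, ?_⟩
  have hQ1 : Tendsto (fun x => Q1 ρ k x * f x) (𝓝[>] 0 ⊓ ae volume) (𝓝 0) := by
    have hcont := (h.continuous_Q1.mul hprim.continuous).tendsto 0
    rw [Pi.mul_apply, h.Q1_zero, zero_mul] at hcont
    exact hcont.mono_left (inf_le_left.trans nhdsWithin_le_nhds)
  have hdiff := Tendsto.sub hφ hQ1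
  rw [sub_zero] at hdiff
  refine hdiff.congr' (mem_inf_of_right ?_)
  filter_upwards [hopD] with x hx
  rw [hx, add_sub_cancel_right]

/-! ### Admissible coefficients -/

namespace Admissible

variable {γ : ℝ → ℝ}

theorem liouvilleCoefficients (h : Admissible ρ k γ) : LiouvilleCoefficients ρ k where
  rho_even := h.rho_even
  k_even := h.k_even
  rho_pos x := apply_abs_of_even h.rho_even x ▸ h.rho_pos _ (abs_nonneg x)
  k_pos x := apply_abs_of_even h.k_even x ▸ h.k_pos _ (abs_nonneg x)
  continuous_rho := continuous_of_even h.rho_even h.rho_C1.continuousOn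
  continuous_k := continuous_of_even h.k_even h.k_C1.continuousOn
  contDiff_mul := by
    simp only [mul_comm (k _)]
    exact contDiff_one_of_even (fun x => by rw [h.rho_even, h.k_even])
      (h.rhok_C2.of_le one_le_two) h.rhok_deriv_zero
  sig_tendsto := h.sig_tendsto

theorem pot_neg (h : Admissible ρ k γ) (x : ℝ) : pot ρ k γ (-x) = pot ρ k γ x := by
  have hQ1 : (fun x => -Q1 ρ k (-x)) = Q1 ρ k := by
    simp only [h.liouvilleCoefficients.Q1_neg, neg_neg]
  have hderiv : deriv (Q1 ρ k) (-x) = deriv (Q1 ρ k) x := by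
    conv_rhs => rw [← hQ1]
    rw [deriv.fun_neg, deriv_comp_neg, neg_neg]
  rw [pot, pot, Q2, Q2, hderiv, h.rho_even, h.k_even, h.gamma_even,
    h.liouvilleCoefficients.Q1_neg, neg_sq]

theorem memLp_pot (h : Admissible ρ k γ) : MemLp (pot ρ k γ) ∞ :=
  memLp_of_even h.pot_neg h.pot_bdd

end Admissible

end HalfAxisHeat

theorem mainTheorem6_general {ρ k γ : ℝ → ℝ} (h : HalfAxisHeat.LiouvilleCoefficients ρ k)
    (hq : MemLp (HalfAxisHeat.pot ρ k γ) ∞) {T : ℝ} (hT : 0 < T) {u : ℝ → ℝ}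
    (hu : IntegrableOn u (Ioo 0 T)) {W0 : HalfAxisHeat.H1 ρ k} {W : ℝ → HalfAxisHeat.H1 ρ k}
    (hW : HalfAxisHeat.IsSolution γ T u W0 W) :
    ∀ᵐ t ∂(volume.restrict (Ioo 0 T)),
      HalfAxisHeat.HasValueAtZeroPlus (HalfAxisHeat.opD (W t)) (u t) ∧
      ∃ wx : ℝ → ℝ, HalfAxisHeat.IsWeakDerivOn (Ioi 0) (HalfAxisHeat.fn (W t)) wx ∧
        HalfAxisHeat.HasValueAtZeroPlus (fun x => √(k x / ρ x) * wx x) (u t) := by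
  filter_upwards [hW.ae_hasValueAtZeroPlus_opD h hq hT.le hu] with t hvalue
  exact ⟨hvalue, HalfAxisHeat.H1.exists_isWeakDerivOn_hasValueAtZeroPlus hvalue h⟩

theorem mainTheorem6 (ρ k γ : ℝ → ℝ) (hcoef : HalfAxisHeat.Admissible ρ k γ)
    (T : ℝ) (hT : 0 < T)
    (u : ℝ → ℝ) (hu : MemLp u ∞ (volume.restrict (Ioo 0 T)))
    (W0 : HalfAxisHeat.H1 ρ k) (hW0 : HalfAxisHeat.IsEven W0)
    (W : ℝ → HalfAxisHeat.H1 ρ k) (hW : HalfAxisHeat.IsSolution γ T u W0 W) :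
    ∀ᵐ t ∂(volume.restrict (Ioo 0 T)),
      HalfAxisHeat.HasValueAtZeroPlus (HalfAxisHeat.opD (W t)) (u t) ∧
      ∃ wx : ℝ → ℝ, HalfAxisHeat.IsWeakDerivOn (Ioi 0) (HalfAxisHeat.fn (W t)) wx ∧
        HalfAxisHeat.HasValueAtZeroPlus (fun x => Real.sqrt (k x / ρ x) * wx x) (u t) :=
  mainTheorem6_general hcoef.liouvilleCoefficients hcoef.memLp_pot hT (hu.integrable le_top) hW
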